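/- Consider a source and a set $V$ of $m$ receiver nodes. The source generates updates $\ell=1,2,\dots$ at the arrival times $\tau_1<\tau_2<\cdots$ of a Poisson process $N_0$ of rate $\lambda_s>0$ (and $\tau_0=0$). For all distinct $i,j\in V$ the directed edge $i\to j$ is activated at the arrival times of a Poisson process of rate $\lambda_e/(m-1)$, where $\lambda_e>0$; all these Poisson processes are mutually independent (a scalable homogeneous network). Let $0\le k<n$ and let $\mathcal S\subseteq V$ be a set of $n$ subscribers. Each update is encoded into $n$ distinct keys, and at time $\tau_\ell$ the source instantaneously sends one key of update $\ell$ to each subscriber, different subscribers getting different keys, and no key to the other nodes (total key subscription, $s=n$). Nodes have memory: whenever the edge $i\to j$ is activated, node $i$ sends to node $j$ all keys, of the current and of the previous updates, that $i$ has received directly from the source; keys received from other nodes are not passed on. A node can decrypt update $\ell$ as soon as it holds at least $k+1$ distinct keys of update $\ell$. Let $N_j^k(t)$ be the latest version that node $j$ can decrypt at time $t$ ($0$ if there is none), and let $A_j(k,t)=N_0(t)-N_j^k(t)$ be the $k$-keys version age of node $j$. Then, with probability $1$, the function $t\mapsto A_j(k,t)$ is locally integrable on $[0,\infty)$, the limit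 $\Delta_j(k)=\lim_{t\to\infty}\frac1t\int_0^t A_j(k,u)\,du$ exists, and $$\Delta_j(k)=\frac{(m-1)\lambda_s}{\lambda_e}\sum_{i=n-k}^{n-1}\frac1i\quad\text{if } j\in\mathcal S \text{ (subscriber)},\qquad \Delta_j(k)=\frac{(m-1)\lambda_s}{\lambda_e}\sum_{i=n-k}^{n}\frac1i\quad\text{if } j\in V\setminus\mathcal S \text{ (nonsubscriber)}.$$ -/

import Mathlib

open MeasureTheory ProbabilityTheory Filter Topology

noncomputable section

namespace GossipAge

/-- The independent random clocks of a fully connected gossip network with set of receiver nodes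
`V`: one clock for the updates of the source, and one clock for each directed edge `i → j` between
distinct receiver nodes. -/
inductive Clock (V : Type*) where
  | source : Clock V
  | edge (i j : V) (h : i ≠ j) : Clock V

/-- The rates of the clocks in a scalable homogeneous network: the source is updated at rate
`lamS`, and each directed edge is activated at rate `lamE / (m - 1)`, `m` the number of receiver
nodes. -/
def rate (V : Type*) [Fintype V] (lamS lamE : ℝ) : Clock V → ℝ
  | .source => lamS
  | .edge _ _ _ => lamE / ((Fintype.card V : ℝ) - 1)

/-- The clocks of a scalable homogeneous network are mutually independent Poisson processes with
the rates above. A Poisson process is given by its times between successive arrivals: `gap c q` is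
the time between the `q`-th and the `(q+1)`-th arrival of the clock `c` (the `0`-th arrival being
time `0`), and these times are independent and exponential with the rate of the clock. -/
structure IsScalableHomogeneous {Ω V : Type*} [MeasurableSpace Ω] [Fintype V]
    (P : Measure Ω) (lamS lamE : ℝ) (gap : Clock V → ℕ → Ω → ℝ) : Prop where
  measurable_gap : ∀ c q, Measurable (gap c q)
  law_gap : ∀ c q, HasLaw (gap c q) (expMeasure (rate V lamS lamE c)) P
  indep_gap : iIndepFun (fun p : Clock V × ℕ => gap p.1 p.2) P

/-- Time of the `q`-th arrival of the clock `c`; the `0`-th arrival time is `0` by convention. -/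
def arrival {Ω V : Type*} (gap : Clock V → ℕ → Ω → ℝ) (c : Clock V) (q : ℕ) (ω : Ω) : ℝ :=
  ∑ r ∈ Finset.range q, gap c r ω

/-- The time `τ_ℓ` at which the source generates the update with version stamp `ℓ`. -/
def updateTime {Ω V : Type*} (gap : Clock V → ℕ → Ω → ℝ) (l : ℕ) (ω : Ω) : ℝ :=
  arrival gap Clock.source l ω

/-- `N₀(t)`: the number of updates of the source up to time `t`, that is, the version at the source
at time `t`. -/
def sourceVersion {Ω V : Type*} (gap : Clock V → ℕ → Ω → ℝ) (t : ℝ) (ω : Ω) : ℕ :=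
  {l : ℕ | 1 ≤ l ∧ updateTime gap l ω ≤ t}.ncard

/-- Total key subscription with set of subscribers `S`. Each update `l` is encoded into the `n`
keys `Fin n`, and `key ω l i` is the key of update `l` that the source sends to node `i` at time
`τ_l` (`none` if it sends no key to `i`). Different nodes get different keys, the nodes that get a
key are exactly the subscribers, and there are as many subscribers as keys. -/
structure IsTotalKeySubscription {Ω V : Type*} (S : Finset V) (n : ℕ)
    (key : Ω → ℕ → V → Option (Fin n)) : Prop where
  card_eq : S.card = n
  isSome_iff : ∀ ω l i, (key ω l i).isSome ↔ i ∈ S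
  unique : ∀ ω l i i' a, key ω l i = some a → key ω l i' = some a → i = i'

/-- The keys of update `l` that node `j` holds at time `t` in the memory scheme: the key that the
source sent to `j` itself, if `τ_l ≤ t`, and the key that the source sent to `i ≠ j`, if the edge
`i → j` has been activated at some time in `[τ_l, t]`. (At each activation of `i → j`, node `i`
passes on all keys that it has received from the source, of the current and the previous updates,
but no key that it got from another receiver node.) -/
def heldKeys {Ω V : Type*} {n : ℕ} (gap : Clock V → ℕ → Ω → ℝ)
    (key : Ω → ℕ → V → Option (Fin n)) (j : V) (l : ℕ) (t : ℝ) (ω : Ω) : Set (Fin n) :=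
  {a | (key ω l j = some a ∧ updateTime gap l ω ≤ t) ∨
    ∃ (i : V) (h : i ≠ j), key ω l i = some a ∧
      ∃ q : ℕ, 1 ≤ q ∧ updateTime gap l ω ≤ arrival gap (Clock.edge i j h) q ω ∧
        arrival gap (Clock.edge i j h) q ω ≤ t}

/-- Node `j` can decrypt update `l` at time `t`: it holds at least `k + 1` distinct keys of it. -/
def CanDecrypt {Ω V : Type*} {n : ℕ} (gap : Clock V → ℕ → Ω → ℝ)
    (key : Ω → ℕ → V → Option (Fin n)) (k : ℕ) (j : V) (l : ℕ) (t : ℝ) (ω : Ω) : Prop :=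
  k + 1 ≤ (heldKeys gap key j l t ω).ncard

/-- The latest version that node `j` can decrypt at time `t` (`0` if there is none yet, so that
every node starts with the initial version `0`). -/
def nodeVersion {Ω V : Type*} {n : ℕ} (gap : Clock V → ℕ → Ω → ℝ)
    (key : Ω → ℕ → V → Option (Fin n)) (k : ℕ) (j : V) (t : ℝ) (ω : Ω) : ℕ :=
  sSup {l : ℕ | CanDecrypt gap key k j l t ω}

/-- The `k`-keys version age `A_j(k, t)` of node `j` at time `t` in the memory scheme. -/
def versionAge {Ω V : Type*} {n : ℕ} (gap : Clock V → ℕ → Ω → ℝ)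
    (key : Ω → ℕ → V → Option (Fin n)) (k : ℕ) (j : V) (t : ℝ) (ω : Ω) : ℝ :=
  (sourceVersion gap t ω : ℝ) - (nodeVersion gap key k j t ω : ℝ)

/-- The function `f` on `[0, ∞)` is locally integrable and has the time average `a`, that is,
`(1 / t) ∫₀ᵗ f` tends to `a` as `t → ∞`. -/
def HasTimeAverage (f : ℝ → ℝ) (a : ℝ) : Prop :=
  (∀ t : ℝ, 0 ≤ t → IntervalIntegrable f volume 0 t) ∧
    Tendsto (fun t : ℝ => (1 / t) * ∫ s in (0 : ℝ)..t, f s) atTop (𝓝 a)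

end GossipAge

end

set_option linter.unusedSectionVars false

/-! An older update has a longer time window, so whenever node `j` can decrypt a version it can
decrypt all earlier ones. Hence the age at time `t` counts the updates up to time `t` that `j`
cannot decrypt yet (`versionAge_eq_sum`). An update of time `s` stays undecrypted as long as fewer
than `κ` of the `N` edges from other subscribers into `j` have been activated in `[s, t]`. Here `N =
n - 1`, `κ = k` for a subscriber, whose own key counts, and `N = n`, `κ = k + 1` otherwise
(`canDecrypt_iff`).

Let `D l` be the time that an update waits. Integrating the count gives a form of Little's law: the
time average of the age is `lamS` times the limiting average of `D l` (`hasTimeAverage_of_path`). By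
memorylessness, `D l` is distributed as the `κ`-th smallest of `N` independent exponential times of
rate `μ = lamE / (m - 1)`; its mean is `(1 / μ) * ∑ j < κ, 1 / (N - j)` (`lintegral_waitingTime`).

The `D l` are dependent, because their windows overlap on the same clocks. Activity in disjoint
windows is independent (`measureReal_undecoded_inter`), so, given the source, the covariance of two
waiting times is at most exponentially small in the time between the updates
(`lintegral_waitingTime_mul_le`). Averaging over the source makes this bound geometric in the
difference of the versions, and a second-moment law of large numbers applies
(`ae_tendsto_average_of_correlation_le`). -/

namespace GossipAge

/-! ### Poisson processes given by their gaps: memorylessness and independence of disjoint windows.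
-/

section

/-- The `q`-th arrival time of a clock with times `x` between successive arrivals. -/
def arrivalTime (x : ℕ → ℝ) (q : ℕ) : ℝ := ∑ r ∈ Finset.range q, x r

/-- No arrival takes place in the closed interval `[s, t]`. -/
def Vacant (x : ℕ → ℝ) (s t : ℝ) : Prop :=
  ∀ q, 1 ≤ q → ¬ (s ≤ arrivalTime x q ∧ arrivalTime x q ≤ t)

/-- The times between successive arrivals of a Poisson process of rate `r`. -/
structure IsPoissonGaps {Ω : Type*} [MeasurableSpace Ω] (P : Measure Ω) (r : ℝ)
    (g : ℕ → Ω → ℝ) : Prop where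
  measurable : ∀ q, Measurable (g q)
  law : ∀ q, HasLaw (g q) (expMeasure r) P
  indep : iIndepFun g P

lemma arrivalTime_succ (x : ℕ → ℝ) (q : ℕ) : arrivalTime x (q + 1) = arrivalTime x q + x q :=
  Finset.sum_range_succ _ _

@[simp] lemma arrivalTime_zero (x : ℕ → ℝ) : arrivalTime x 0 = 0 := by simp [arrivalTime]

lemma arrivalTime_congr {x y : ℕ → ℝ} {q : ℕ} (h : ∀ r < q, x r = y r) :
    arrivalTime x q = arrivalTime y q :=
  Finset.sum_congr rfl fun r hr => h r (Finset.mem_range.1 hr)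

lemma monotone_arrivalTime {x : ℕ → ℝ} (h : ∀ q, 0 < x q) : Monotone (arrivalTime x) :=
  monotone_nat_of_le_succ fun q => by rw [arrivalTime_succ]; linarith [h q]

@[fun_prop]
lemma measurable_arrivalTime (q : ℕ) : Measurable fun x : ℕ → ℝ => arrivalTime x q := by
  unfold arrivalTime; fun_prop

lemma expMeasure_Iic {r : ℝ} (hr : 0 < r) {x : ℝ} (hx : 0 ≤ x) :
    expMeasure r (Set.Iic x) = ENNReal.ofReal (1 - Real.exp (-(r * x))) := by
  have := isProbabilityMeasure_expMeasure hr
  have h := cdf_expMeasure_eq hr x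
  rw [if_pos hx, cdf_eq_real, Measure.real] at h
  rw [← h, ENNReal.ofReal_toReal (measure_ne_top _ _)]

lemma expMeasure_Ioi {r : ℝ} (hr : 0 < r) {x : ℝ} (hx : 0 ≤ x) :
    expMeasure r (Set.Ioi x) = ENNReal.ofReal (Real.exp (-(r * x))) := by
  have := isProbabilityMeasure_expMeasure hr
  have h1 : Real.exp (-(r * x)) ≤ 1 := Real.exp_le_one_iff.2 (by nlinarith)
  rw [← Set.compl_Iic, prob_compl_eq_one_sub measurableSet_Iic, expMeasure_Iic hr hx,
    ← ENNReal.ofReal_one, ← ENNReal.ofReal_sub _ (by linarith)]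
  congr 1; ring

instance (r : ℝ) : NullSingletonClass (expMeasure r) := by
  unfold expMeasure gammaMeasure; infer_instance

lemma expMeasure_Ici {r : ℝ} (hr : 0 < r) {x : ℝ} (hx : 0 ≤ x) :
    expMeasure r (Set.Ici x) = ENNReal.ofReal (Real.exp (-(r * x))) := by
  rw [← expMeasure_Ioi hr hx]; exact (measure_congr Ioi_ae_eq_Ici).symm

variable {Ω : Type*} [MeasurableSpace Ω] {P : Measure Ω} [IsProbabilityMeasure P]
  {r : ℝ} {g : ℕ → Ω → ℝ}

/-- Fubini for independent variables. It serves to freeze the past of a clock in `memoryless`, and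
later to freeze the whole source path. -/
lemma measure_indepFun_pair {β γ : Type*} [MeasurableSpace β] [MeasurableSpace γ]
    {X : Ω → β} {Y : Ω → γ} (hX : Measurable X) (hY : Measurable Y) (h : IndepFun X Y P)
    {f : β × γ → ENNReal} (hf : Measurable f) :
    ∫⁻ ω, f (X ω, Y ω) ∂P = ∫⁻ x, ∫⁻ y, f (x, y) ∂(P.map Y) ∂(P.map X) := by
  have h1 := (indepFun_iff_map_prod_eq_prod_map_map hX.aemeasurable hY.aemeasurable).1 h
  have := Measure.isProbabilityMeasure_map (μ := P) hY.aemeasurable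
  rw [← lintegral_prod _ hf.aemeasurable, ← h1, lintegral_map hf (hX.prodMk hY)]

/-- Memorylessness of an exponential time that is independent of the past. -/
lemma memoryless {β : Type*} [MeasurableSpace β] (hr : 0 < r) {X : Ω → β} {G : Ω → ℝ}
    (hX : Measurable X) (hG : Measurable G) (hlaw : HasLaw G (expMeasure r) P)
    (hind : IndepFun X G P) {A : Set β} (hA : MeasurableSet A) {h : β → ℝ} (hh : Measurable h)
    (h0 : ∀ x ∈ A, 0 ≤ h x) {w : ℝ} (hw : 0 ≤ w) :
    P {ω | X ω ∈ A ∧ h (X ω) + w < G ω} =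
      ENNReal.ofReal (Real.exp (-(r * w))) * P {ω | X ω ∈ A ∧ h (X ω) ≤ G ω} := by
  have key : ∀ B : Set (β × ℝ), MeasurableSet B → P {ω | (X ω, G ω) ∈ B} =
      ∫⁻ x, expMeasure r (Prod.mk x ⁻¹' B) ∂(P.map X) := by
    intro B hB
    have := measure_indepFun_pair hX hG hind (f := B.indicator 1) (measurable_one.indicator hB)
    rw [hlaw.map_eq] at this
    have e1 : ∫⁻ ω, B.indicator 1 (X ω, G ω) ∂P = P {ω | (X ω, G ω) ∈ B} := by
      exact lintegral_indicator_one (μ := P) (s := {ω | (X ω, G ω) ∈ B}) ((hX.prodMk hG) hB)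
    rw [← e1, this]
    refine lintegral_congr fun x => ?_
    exact lintegral_indicator_one (s := Prod.mk x ⁻¹' B) (measurable_prodMk_left hB)
  have m1 : MeasurableSet {p : β × ℝ | p.1 ∈ A ∧ h p.1 + w < p.2} :=
    (measurable_fst hA).inter
      (measurableSet_lt (f := fun p : β × ℝ => h p.1 + w) (by fun_prop) measurable_snd)
  have m2 : MeasurableSet {p : β × ℝ | p.1 ∈ A ∧ h p.1 ≤ p.2} :=
    (measurable_fst hA).inter
      (measurableSet_le (f := fun p : β × ℝ => h p.1) (by fun_prop) measurable_snd)
  have k1 := key _ m1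
  have k2 := key _ m2
  simp only [Set.mem_ofPred_eq] at k1 k2
  rw [k1, k2, ← lintegral_const_mul]
  · refine lintegral_congr fun x => ?_
    by_cases hx : x ∈ A
    · have e1 : Prod.mk x ⁻¹' {p : β × ℝ | p.1 ∈ A ∧ h p.1 + w < p.2} = Set.Ioi (h x + w) := by
        ext y; simp [hx]
      have e2 : Prod.mk x ⁻¹' {p : β × ℝ | p.1 ∈ A ∧ h p.1 ≤ p.2} = Set.Ici (h x) := by
        ext y; simp [hx]
      rw [e1, e2, expMeasure_Ioi hr (by linarith [h0 x hx]), expMeasure_Ici hr (h0 x hx),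
        ← ENNReal.ofReal_mul (Real.exp_nonneg _), ← Real.exp_add]
      congr 2; ring
    · have e1 : Prod.mk x ⁻¹' {p : β × ℝ | p.1 ∈ A ∧ h p.1 + w < p.2} = ∅ := by
        ext y; simp [hx]
      have e2 : Prod.mk x ⁻¹' {p : β × ℝ | p.1 ∈ A ∧ h p.1 ≤ p.2} = ∅ := by
        ext y; simp [hx]
      rw [e1, e2]; simp
  · have := isProbabilityMeasure_expMeasure hr
    exact measurable_measure_prodMk_left m2

namespace IsPoissonGaps

omit [IsProbabilityMeasure P] in
lemma measure_lt (hg : IsPoissonGaps P r g) (hr : 0 < r) (q : ℕ) {x : ℝ} (hx : 0 ≤ x) :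
    P {ω | x < g q ω} = ENNReal.ofReal (Real.exp (-(r * x))) := by
  rw [← expMeasure_Ioi hr hx, ← (hg.law q).map_eq, Measure.map_apply (hg.measurable q)
    measurableSet_Ioi]; rfl

lemma ae_pos (hg : IsPoissonGaps P r g) (hr : 0 < r) : ∀ᵐ ω ∂P, ∀ q, 0 < g q ω := by
  rw [ae_all_iff]
  intro q
  have h := hg.measure_lt hr q le_rfl
  rw [mul_zero, neg_zero, Real.exp_zero, ENNReal.ofReal_one] at h
  exact (prob_compl_eq_zero_iff (measurableSet_lt measurable_const (hg.measurable q))).2 h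

/-- The layer-cake formula reduces the mean to the integral of the exponential tail. -/
lemma lintegral_ofReal (hg : IsPoissonGaps P r g) (hr : 0 < r) (q : ℕ) :
    ∫⁻ ω, ENNReal.ofReal (g q ω) ∂P = ENNReal.ofReal (1 / r) := by
  rw [lintegral_eq_lintegral_meas_lt P ((hg.ae_pos hr).mono fun ω h => (h q).le)
    (hg.measurable q).aemeasurable]
  rw [setLIntegral_congr_fun measurableSet_Ioi
    (g := fun x => ENNReal.ofReal (Real.exp (-r * x)))
    (fun x hx => by simpa using hg.measure_lt hr q (le_of_lt hx))]
  rw [← ofReal_integral_eq_lintegral_ofReal (exp_neg_integrableOn_Ioi 0 hr)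
    (ae_of_all _ fun x => Real.exp_nonneg _), integral_exp_mul_Ioi (by linarith)]
  congr 1; field_simp; simp

lemma integrable (hg : IsPoissonGaps P r g) (hr : 0 < r) (q : ℕ) : Integrable (g q) P := by
  refine ⟨(hg.measurable q).aestronglyMeasurable, ?_⟩
  rw [hasFiniteIntegral_iff_ofReal ((hg.ae_pos hr).mono fun ω h => (h q).le),
    hg.lintegral_ofReal hr]
  exact ENNReal.ofReal_lt_top

lemma integral_eq (hg : IsPoissonGaps P r g) (hr : 0 < r) (q : ℕ) : ∫ ω, g q ω ∂P = 1 / r := by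
  rw [integral_eq_lintegral_of_nonneg_ae ((hg.ae_pos hr).mono fun ω h => (h q).le)
    (hg.measurable q).aestronglyMeasurable, hg.lintegral_ofReal hr,
    ENNReal.toReal_ofReal (by positivity)]

/-- The law of large numbers for the arrival times. -/
lemma ae_tendsto_arrivalTime_div (hg : IsPoissonGaps P r g) (hr : 0 < r) :
    ∀ᵐ ω ∂P, Tendsto (fun q : ℕ => arrivalTime (g · ω) q / q) atTop (𝓝 (1 / r)) := by
  have h := strong_law_ae_real g (hg.integrable hr 0) (fun i j hij => hg.indep.indepFun hij)
    fun i => ⟨(hg.measurable i).aemeasurable, (hg.measurable 0).aemeasurable, by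
      rw [(hg.law i).map_eq, (hg.law 0).map_eq]⟩
  rw [hg.integral_eq hr] at h
  exact h

lemma ae_tendsto_arrivalTime (hg : IsPoissonGaps P r g) (hr : 0 < r) :
    ∀ᵐ ω ∂P, Tendsto (fun q : ℕ => arrivalTime (g · ω) q) atTop atTop := by
  filter_upwards [hg.ae_tendsto_arrivalTime_div hr] with ω h
  have h2 := h.pos_mul_atTop (by positivity) (tendsto_natCast_atTop_atTop (R := ℝ))
  refine h2.congr' ?_
  filter_upwards [eventually_gt_atTop 0] with q hq
  field_simp

end IsPoissonGaps

lemma measurableSet_vacant (s t : ℝ) : MeasurableSet {x : ℕ → ℝ | Vacant x s t} := by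
  refine measurableSet_setOfPred.2 (.forall fun q => .imp measurable_const (.not (.and ?_ ?_)))
  · exact measurableSet_setOfPred.1 (measurableSet_le measurable_const (measurable_arrivalTime q))
  · exact measurableSet_setOfPred.1 (measurableSet_le (measurable_arrivalTime q) measurable_const)

/-- The arrival `q + 1` is the first one at time `s` or later. -/
def FirstPassage (x : ℕ → ℝ) (s : ℝ) (q : ℕ) : Prop :=
  (∀ p ≤ q, arrivalTime x p < s) ∧ s ≤ arrivalTime x (q + 1)

lemma measurableSet_firstPassage (s : ℝ) (q : ℕ) :
    MeasurableSet {x : ℕ → ℝ | FirstPassage x s q} := by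
  refine measurableSet_setOfPred.2 (.and (.forall fun p => .imp measurable_const ?_) ?_)
  · exact measurableSet_setOfPred.1 (measurableSet_lt (measurable_arrivalTime p) measurable_const)
  · exact measurableSet_setOfPred.1 (measurableSet_le measurable_const (measurable_arrivalTime _))

lemma exists_firstPassage {x : ℕ → ℝ} {s : ℝ} (hs : 0 < s)
    (hx : Tendsto (arrivalTime x) atTop atTop) : ∃ q, FirstPassage x s q := by
  classical
  have h : ∃ q, s ≤ arrivalTime x q := (hx.eventually_ge_atTop s).exists
  -- Index `0` stands for time `0` and is not an arrival; `0 < s` excludes it.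
  have h0 : Nat.find h ≠ 0 := by
    intro h0
    have := Nat.find_spec h
    rw [h0, arrivalTime_zero] at this
    linarith
  obtain ⟨q, hq⟩ := Nat.exists_eq_succ_of_ne_zero h0
  refine ⟨q, fun p hp => not_le.1 (Nat.find_min h (by omega)), ?_⟩
  have := Nat.find_spec h
  rwa [hq] at this

/-- `FirstPassage` constrains every index up to `q`, so no monotonicity of the arrival times is
needed; the gaps are positive only almost surely. -/
lemma FirstPassage.unique {x : ℕ → ℝ} {s : ℝ} {p q : ℕ} (hp : FirstPassage x s p)
    (hq : FirstPassage x s q) : p = q := by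
  by_contra hne
  rcases lt_or_gt_of_ne hne with h | h
  · linarith [hq.1 (p + 1) h, hp.2]
  · linarith [hp.1 (q + 1) h, hq.2]

/-- Splitting an event according to the index of the first arrival after time `s`. -/
lemma IsPoissonGaps.measure_eq_tsum (hg : IsPoissonGaps P r g) (hr : 0 < r) {s : ℝ} (hs : 0 < s)
    {E : Set Ω} (hE : MeasurableSet E) :
    P E = ∑' q, P (E ∩ {ω | FirstPassage (g · ω) s q}) := by
  have hm : Measurable fun ω q => g q ω := measurable_pi_lambda _ hg.measurable
  rw [← measure_iUnion]
  · rw [← Set.inter_iUnion]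
    refine measure_congr ?_
    filter_upwards [hg.ae_tendsto_arrivalTime hr] with ω hω
    obtain ⟨q, hq⟩ := exists_firstPassage hs hω
    refine propext ⟨fun h => ⟨h, Set.mem_iUnion.2 ⟨q, hq⟩⟩, fun h => h.1⟩
  · intro p q hpq
    refine Set.disjoint_left.2 fun ω hp hq => hpq (hp.2.unique hq.2)
  · exact fun q => hE.inter (hm (measurableSet_firstPassage s q))

/-- Vacancy of an interval is independent of vacancy of an earlier one. -/
theorem IsPoissonGaps.measure_vacant_inter (hg : IsPoissonGaps P r g) (hr : 0 < r)
    {s t s' t' : ℝ} (h1 : t < s') (h2 : s' ≤ t') (hs : 0 < s') :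
    P {ω | Vacant (g · ω) s t ∧ Vacant (g · ω) s' t'} =
      ENNReal.ofReal (Real.exp (-(r * (t' - s')))) * P {ω | Vacant (g · ω) s t} := by
  have hm : Measurable fun ω q => g q ω := measurable_pi_lambda _ hg.measurable
  have mV : ∀ a b, MeasurableSet {ω | Vacant (g · ω) a b} :=
    fun a b => hm (measurableSet_vacant a b)
  have mVV : MeasurableSet {ω | Vacant (g · ω) s t ∧ Vacant (g · ω) s' t'} :=
    (mV s t).inter (mV s' t')
  rw [hg.measure_eq_tsum hr hs mVV, hg.measure_eq_tsum hr hs (mV s t),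
    ← ENNReal.tsum_mul_left]
  refine tsum_congr fun q => ?_
  -- The past before gap `q`, padded with zeros so that `arrivalTime` still applies to it. Since `t
  -- < s'`, on the event that arrival `q + 1` is the first at or after `s'`, vacancy of `[s, t]`
  -- depends on `X` only. Vacancy of `[s', t']` then says that gap `q` exceeds the residual `s' -
  -- arrivalTime X q` by more than `t' - s'`.
  let X : Ω → ℕ → ℝ := fun ω r => if r < q then g r ω else 0
  have hX : Measurable X := measurable_pi_lambda _ fun r => by
    by_cases h : r < q
    · simpa [X, h] using hg.measurable r
    · simp [X, h]
  have hind : IndepFun X (g q) P := by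
    have := hg.indep.indepFun_finset (Finset.range q) {q} (by simp) hg.measurable
    refine this.comp (φ := fun y r => if h : r ∈ Finset.range q then y ⟨r, h⟩ else 0)
      (ψ := fun y : ({q} : Finset ℕ) → ℝ => y ⟨q, by simp⟩) ?_ (by fun_prop) |>.congr ?_ ?_
    · refine measurable_pi_lambda _ fun r => ?_
      by_cases h : r < q
      · simpa [h] using measurable_pi_apply _
      · simp [h]
    · refine ae_of_all _ fun ω => ?_
      ext r; simp [X]
    · exact ae_of_all _ fun ω => rfl
  let A : Set (ℕ → ℝ) := {x | (∀ p ≤ q, arrivalTime x p < s') ∧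
    ∀ p ≤ q, 1 ≤ p → ¬ (s ≤ arrivalTime x p ∧ arrivalTime x p ≤ t)}
  have hA : MeasurableSet A := by
    refine measurableSet_setOfPred.2 (.and (.forall fun p => .imp measurable_const ?_)
      (.forall fun p => .imp measurable_const (.imp measurable_const (.not (.and ?_ ?_)))))
    · exact measurableSet_setOfPred.1 (measurableSet_lt (measurable_arrivalTime p) measurable_const)
    · exact measurableSet_setOfPred.1 (measurableSet_le measurable_const (measurable_arrivalTime p))
    · exact measurableSet_setOfPred.1 (measurableSet_le (measurable_arrivalTime p) measurable_const)
  have key := memoryless hr hX (hg.measurable q) (hg.law q) hind hA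
    (h := fun x => s' - arrivalTime x q) (by fun_prop)
    (fun x hx => by have := hx.1 q le_rfl; linarith) (sub_nonneg.2 h2)
  have hXa : ∀ ω, ∀ p ≤ q, arrivalTime (X ω) p = arrivalTime (g · ω) p := fun ω p hp =>
    arrivalTime_congr fun r hr => by simp [X, lt_of_lt_of_le hr hp]
  have hXA : ∀ ω, X ω ∈ A ↔ (∀ p ≤ q, arrivalTime (g · ω) p < s') ∧
      ∀ p ≤ q, 1 ≤ p → ¬ (s ≤ arrivalTime (g · ω) p ∧ arrivalTime (g · ω) p ≤ t) := by
    intro ω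
    refine and_congr (forall₂_congr fun p hp => by rw [hXa ω p hp])
      (forall₂_congr fun p hp => by rw [hXa ω p hp])
  refine Eq.trans (measure_congr ?_) (key.trans (congrArg _ (measure_congr ?_)))
  · filter_upwards [hg.ae_pos hr] with ω hpos
    have hmono := monotone_arrivalTime hpos
    refine propext (Iff.trans (b := (X ω ∈ A ∧ s' - arrivalTime (X ω) q + (t' - s') < g q ω)) ?_
      Iff.rfl)
    rw [hXA, hXa ω q le_rfl]
    have hq := arrivalTime_succ (g · ω) q
    constructor
    · rintro ⟨⟨hv, hv'⟩, hf⟩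
      refine ⟨⟨hf.1, fun p hp => hv p⟩, ?_⟩
      have := hv' (q + 1) (by omega)
      have h3 := hf.2
      simp only [not_and, not_le] at this
      linarith [this h3]
    · rintro ⟨⟨ha, hb⟩, hc⟩
      have hlt : t' < arrivalTime (g · ω) (q + 1) := by linarith
      refine ⟨⟨fun p hp => ?_, fun p hp => ?_⟩, ha, by linarith⟩
      · by_cases hpq : p ≤ q
        · exact hb p hpq hp
        · have := hmono (show q + 1 ≤ p by omega)
          rintro ⟨_, h⟩; linarith
      · by_cases hpq : p ≤ q
        · have := ha p hpq
          rintro ⟨h, _⟩; linarith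
        · have := hmono (show q + 1 ≤ p by omega)
          rintro ⟨_, h⟩; linarith
  · filter_upwards [hg.ae_pos hr] with ω hpos
    have hmono := monotone_arrivalTime hpos
    refine propext (Iff.trans (b := (X ω ∈ A ∧ s' - arrivalTime (X ω) q ≤ g q ω)) Iff.rfl ?_)
    rw [hXA, hXa ω q le_rfl]
    have hq := arrivalTime_succ (g · ω) q
    constructor
    · rintro ⟨⟨ha, hb⟩, hc⟩
      refine ⟨fun p hp => ?_, ha, by linarith⟩
      by_cases hpq : p ≤ q
      · exact hb p hpq hp
      · have := hmono (show q + 1 ≤ p by omega)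
        rintro ⟨_, h⟩; linarith
    · rintro ⟨hv, hf⟩
      exact ⟨⟨hf.1, fun p hp => hv p⟩, by linarith [hf.2]⟩

lemma IsPoissonGaps.measure_vacant (hg : IsPoissonGaps P r g) (hr : 0 < r)
    {s t : ℝ} (hs : 0 < s) (h : s ≤ t) :
    P {ω | Vacant (g · ω) s t} = ENNReal.ofReal (Real.exp (-(r * (t - s)))) := by
  -- A reversed interval is empty, hence always vacant, so the earlier window imposes no condition.
  have h0 : ∀ x : ℕ → ℝ, Vacant x (s / 2) (s / 4) := fun x q _ h => by linarith [h.1, h.2]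
  have := hg.measure_vacant_inter hr (s := s / 2) (t := s / 4) (by linarith) h hs
  simpa [h0] using this

end

/-! ### Families of independent Poisson clocks: the set of clocks active in a window. -/

section

/-- The clocks among `y` with an arrival in `[s, t]`. -/
noncomputable def activeSet {ι : Type*} [Fintype ι] (y : ι → ℕ → ℝ) (s t : ℝ) : Finset ι := by
  classical exact Finset.univ.filter fun i => ¬ Vacant (y i) s t

lemma mem_activeSet {ι : Type*} [Fintype ι] {y : ι → ℕ → ℝ} {s t : ℝ} {i : ι} :
    i ∈ activeSet y s t ↔ ¬ Vacant (y i) s t := by simp [activeSet]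

/-- Fewer than `κ` of the clocks `y` have an arrival in `[s, t]`. -/
def Undecoded {ι : Type*} [Fintype ι] (κ : ℕ) (y : ι → ℕ → ℝ) (s t : ℝ) : Prop :=
  (activeSet y s t).card < κ

lemma Vacant.mono {x : ℕ → ℝ} {s t s' t' : ℝ} (h : Vacant x s t) (hs : s ≤ s') (ht : t' ≤ t) :
    Vacant x s' t' := fun q hq hh => h q hq ⟨hs.trans hh.1, hh.2.trans ht⟩

lemma Undecoded.mono {ι : Type*} [Fintype ι] {κ : ℕ} {y : ι → ℕ → ℝ} {s t s' t' : ℝ}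
    (h : Undecoded κ y s t) (hs : s ≤ s') (ht : t' ≤ t) : Undecoded κ y s' t' :=
  (Finset.card_le_card fun _ hi => mem_activeSet.2 fun hv =>
    mem_activeSet.1 hi (hv.mono hs ht)).trans_lt h

section measurability

variable {α : Type*} [MeasurableSpace α]

lemma measurable_vacant {x : α → ℕ → ℝ} {s t : α → ℝ} (hx : Measurable x) (hs : Measurable s)
    (ht : Measurable t) : Measurable fun a => Vacant (x a) (s a) (t a) := by
  have hq : ∀ q, Measurable fun a => arrivalTime (x a) q := fun q =>
    (measurable_arrivalTime q).comp hx
  refine .forall fun q => .imp measurable_const (.not (.and ?_ ?_))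
  · exact measurableSet_setOfPred.1 (measurableSet_le hs (hq q))
  · exact measurableSet_setOfPred.1 (measurableSet_le (hq q) ht)

variable {ι : Type*} [Fintype ι]

lemma measurable_undecoded {κ : ℕ} {y : α → ι → ℕ → ℝ} {s t : α → ℝ} (hy : Measurable y)
    (hs : Measurable s) (ht : Measurable t) :
    Measurable fun a => Undecoded κ (y a) (s a) (t a) := by
  classical
  have h : Measurable fun a => (activeSet (y a) (s a) (t a)).card := by
    have : ∀ a, (activeSet (y a) (s a) (t a)).card =
        ∑ i, if ¬ Vacant (y a i) (s a) (t a) then 1 else 0 := fun a => by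
      rw [← Finset.card_filter]; simp [activeSet]
    simp only [this]
    refine Finset.measurable_sum _ fun i _ => ?_
    exact Measurable.ite (measurableSet_setOfPred.2
      (measurable_vacant ((measurable_pi_apply i).comp hy) hs ht).not) measurable_const
      measurable_const
  exact measurableSet_setOfPred.1 (measurableSet_lt h measurable_const)

end measurability

variable {Ω : Type*} [MeasurableSpace Ω] {P : Measure Ω} [IsProbabilityMeasure P]
  {ι : Type*} [Fintype ι]

/-- The times between successive arrivals of independent Poisson processes of rate `μ`. -/
structure IsPoissonFamily (P : Measure Ω) (μ : ℝ) (y : ι → ℕ → Ω → ℝ) : Prop where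
  poisson : ∀ i, IsPoissonGaps P μ (y i)
  indep : iIndepFun (fun i ω q => y i q ω) P

variable {μ : ℝ} {y : ι → ℕ → Ω → ℝ}

namespace IsPoissonFamily

lemma measurable (hy : IsPoissonFamily P μ y) : Measurable fun ω i q => y i q ω :=
  measurable_pi_lambda _ fun i => measurable_pi_lambda _ fun q => (hy.poisson i).measurable q

lemma indepSet_vacant (hy : IsPoissonFamily P μ y) (hμ : 0 < μ) (i : ι) {s t s' t' : ℝ}
    (h : s ≤ t) (h1 : t < s') (h2 : s' ≤ t') (hs : 0 < s) :
    IndepSet {ω | Vacant (y i · ω) s t} {ω | Vacant (y i · ω) s' t'} P := by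
  have hm : Measurable fun ω q => y i q ω := measurable_pi_lambda _ (hy.poisson i).measurable
  have mV : ∀ a b, MeasurableSet {ω | Vacant (y i · ω) a b} :=
    fun a b => hm (measurableSet_vacant a b)
  refine (indepSet_iff_measure_inter_eq_mul (mV s t) (mV s' t') P).2 ?_
  refine ((hy.poisson i).measure_vacant_inter hμ h1 h2 (by linarith)).trans ?_
  rw [(hy.poisson i).measure_vacant hμ (by linarith) h2, mul_comm]

lemma measureReal_activeSet_eq (hy : IsPoissonFamily P μ y) (s t : ℝ) (I : Finset ι) :
    P.real {ω | activeSet (fun i q => y i q ω) s t = I} =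
      ∏ i, P.real {ω | ¬ Vacant (y i · ω) s t ↔ i ∈ I} := by
  have h := hy.indep.measure_inter_preimage_eq_mul Finset.univ
    (sets := fun i => {x : ℕ → ℝ | ¬ Vacant x s t ↔ i ∈ I}) (fun i _ =>
      measurableSet_setOfPred.2 (.iff (measurableSet_setOfPred.1 (measurableSet_vacant s t)).not
        measurable_const))
  simp only [Measure.real]
  rw [← ENNReal.toReal_prod]
  congr 1
  refine Eq.trans (congrArg P ?_) h
  ext ω
  simp [Finset.ext_iff, mem_activeSet]

/-- Independence across clocks splits the joint event into one factor per clock; independence of the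
two windows then splits each factor. -/
lemma measureReal_activeSet_pair_eq (hy : IsPoissonFamily P μ y) (hμ : 0 < μ) {s t s' t' : ℝ}
    (h : s ≤ t) (h1 : t < s') (h2 : s' ≤ t') (hs : 0 < s) (I I' : Finset ι) :
    P.real {ω | activeSet (fun i q => y i q ω) s t = I ∧
      activeSet (fun i q => y i q ω) s' t' = I'} =
      P.real {ω | activeSet (fun i q => y i q ω) s t = I} *
      P.real {ω | activeSet (fun i q => y i q ω) s' t' = I'} := by
  have m : ∀ s t (I : Finset ι) i, MeasurableSet {x : ℕ → ℝ | ¬ Vacant x s t ↔ i ∈ I} :=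
    fun s t I i => measurableSet_setOfPred.2
      (.iff (measurableSet_setOfPred.1 (measurableSet_vacant s t)).not measurable_const)
  rw [hy.measureReal_activeSet_eq, hy.measureReal_activeSet_eq, ← Finset.prod_mul_distrib]
  have key := hy.indep.measure_inter_preimage_eq_mul Finset.univ
    (sets := fun i => {x : ℕ → ℝ | ¬ Vacant x s t ↔ i ∈ I} ∩ {x | ¬ Vacant x s' t' ↔ i ∈ I'})
    (fun i _ => (m s t I i).inter (m s' t' I' i))
  simp only [Measure.real, ← ENNReal.toReal_mul]
  rw [← ENNReal.toReal_prod]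
  congr 1
  refine Eq.trans (congrArg P ?_) (key.trans (Finset.prod_congr rfl fun i _ => ?_))
  · ext ω
    simp only [Finset.ext_iff, mem_activeSet, Finset.mem_univ, Set.iInter_true,
      Set.mem_iInter, Set.mem_preimage, Set.mem_inter_iff, Set.mem_ofPred_eq]
    exact forall_and.symm
  · have hi := hy.indepSet_vacant hμ i h h1 h2 hs
    -- The event is the vacancy event or its complement, so it lies in the σ-algebra that vacancy
    -- generates, and `IndepSet` covers it.
    have gen : ∀ s t (I : Finset ι),
        MeasurableSet[MeasurableSpace.generateFrom {{ω | Vacant (y i · ω) s t}}]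
          {ω | ¬ Vacant (y i · ω) s t ↔ i ∈ I} := by
      intro s t I
      have hb : MeasurableSet[MeasurableSpace.generateFrom {{ω | Vacant (y i · ω) s t}}]
          {ω | Vacant (y i · ω) s t} := MeasurableSpace.measurableSet_generateFrom rfl
      by_cases hI : i ∈ I
      · simp only [hI, iff_true]; exact hb.compl
      · simp only [hI, iff_false, not_not]; exact hb
    exact (Indep_iff _ _ _).1 hi _ _ (gen s t I) (gen s' t' I')

lemma measureReal_eq_sum {α : Type*} [Fintype α] (F : Ω → α)
    (hF : ∀ a, MeasurableSet {ω | F ω = a}) (p : α → Prop) [DecidablePred p] :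
    P.real {ω | p (F ω)} = ∑ a with p a, P.real {ω | F ω = a} := by
  have := sum_measureReal_preimage_singleton (μ := P) (f := F)
    (Finset.univ.filter p) (fun a _ => hF a)
  rw [← show P.real (F ⁻¹' ↑(Finset.univ.filter p)) = P.real {ω | p (F ω)} by
    congr 1; ext ω; simp, ← this]
  rfl

lemma measurableSet_activeSet_eq (hy : IsPoissonFamily P μ y) (s t : ℝ) (I : Finset ι) :
    MeasurableSet {ω | activeSet (fun i q => y i q ω) s t = I} := by
  have : {ω | activeSet (fun i q => y i q ω) s t = I} =
      {ω | ∀ i, ¬ Vacant (y i · ω) s t ↔ i ∈ I} := by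
    ext ω; simp [Finset.ext_iff, mem_activeSet]
  rw [this]
  exact measurableSet_setOfPred.2 (.forall fun i => .iff (measurable_vacant
    (measurable_pi_lambda _ (hy.poisson i).measurable) measurable_const measurable_const).not
    measurable_const)

/-- What happens in disjoint intervals is independent. -/
theorem measureReal_undecoded_inter (hy : IsPoissonFamily P μ y) (hμ : 0 < μ) {s t s' t' : ℝ}
    (h : s ≤ t) (h1 : t < s') (h2 : s' ≤ t') (hs : 0 < s) (κ : ℕ) :
    P.real {ω | Undecoded κ (fun i q => y i q ω) s t ∧ Undecoded κ (fun i q => y i q ω) s' t'} =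
      P.real {ω | Undecoded κ (fun i q => y i q ω) s t} *
      P.real {ω | Undecoded κ (fun i q => y i q ω) s' t'} := by
  classical
  have e := measureReal_eq_sum (P := P) (fun ω => (activeSet (fun i q => y i q ω) s t,
    activeSet (fun i q => y i q ω) s' t')) (fun a => by
      simp only [Prod.ext_iff]
      exact (hy.measurableSet_activeSet_eq s t a.1).inter
        (hy.measurableSet_activeSet_eq s' t' a.2)) (fun a => a.1.card < κ ∧ a.2.card < κ)
  have e1 := fun s t => measureReal_eq_sum (P := P) (fun ω => activeSet (fun i q => y i q ω) s t)
    (hy.measurableSet_activeSet_eq s t) (fun a => a.card < κ)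
  unfold Undecoded
  rw [e1, e1, Finset.sum_mul_sum, ← Finset.sum_product']
  refine e.trans ?_
  refine Finset.sum_congr ?_ fun a _ => ?_
  · ext a; simp
  · simp only [Prod.ext_iff]
    exact hy.measureReal_activeSet_pair_eq hμ h h1 h2 hs a.1 a.2

lemma measureReal_vacant (hy : IsPoissonFamily P μ y) (hμ : 0 < μ) (i : ι) {s t : ℝ}
    (hs : 0 < s) (h : s ≤ t) :
    P.real {ω | Vacant (y i · ω) s t} = Real.exp (-(μ * (t - s))) := by
  rw [Measure.real, (hy.poisson i).measure_vacant hμ hs h,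
    ENNReal.toReal_ofReal (Real.exp_nonneg _)]

/-- The number of clocks with an arrival in `[s, t]` has a binomial distribution. -/
theorem measureReal_undecoded (hy : IsPoissonFamily P μ y) (hμ : 0 < μ) {s t : ℝ}
    (hs : 0 < s) (h : s ≤ t) (κ : ℕ) :
    P.real {ω | Undecoded κ (fun i q => y i q ω) s t} =
      ∑ j ∈ Finset.range κ, ((Fintype.card ι).choose j : ℝ) *
        ((1 - Real.exp (-(μ * (t - s)))) ^ j *
          Real.exp (-(μ * (t - s))) ^ (Fintype.card ι - j)) := by
  classical
  set p := Real.exp (-(μ * (t - s))) with hp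
  have hI : ∀ I : Finset ι, P.real {ω | activeSet (fun i q => y i q ω) s t = I} =
      (1 - p) ^ I.card * p ^ (Fintype.card ι - I.card) := by
    intro I
    rw [hy.measureReal_activeSet_eq]
    have : ∀ i, P.real {ω | ¬ Vacant (y i · ω) s t ↔ i ∈ I} = if i ∈ I then 1 - p else p := by
      intro i
      have hm : Measurable fun ω q => y i q ω :=
        measurable_pi_lambda _ (hy.poisson i).measurable
      have hV : MeasurableSet {ω | Vacant (y i · ω) s t} := hm (measurableSet_vacant _ _)
      split_ifs with hi
      · simp only [hi, iff_true]
        refine (probReal_compl_eq_one_sub hV).trans ?_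
        rw [hy.measureReal_vacant hμ i hs h]
      · simp only [hi, iff_false, not_not]
        exact hy.measureReal_vacant hμ i hs h
    simp only [this]
    rw [Finset.prod_ite, Finset.prod_const, Finset.prod_const]
    congr 2
    · simp
    · rw [Finset.filter_not, ← Finset.compl_eq_univ_sdiff, Finset.card_compl]; simp
  unfold Undecoded
  rw [measureReal_eq_sum (P := P) (fun ω => activeSet (fun i q => y i q ω) s t)
    (hy.measurableSet_activeSet_eq s t) (fun a => a.card < κ)]
  simp only [hI]
  rw [← Finset.sum_fiberwise_of_maps_to (t := Finset.range κ) (g := Finset.card)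
    (by intro a; simp)]
  refine Finset.sum_congr rfl fun j hj => ?_
  rw [Finset.sum_congr (s₂ := Finset.univ.powersetCard j)
    (g := fun _ => (1 - p) ^ j * p ^ (Fintype.card ι - j))]
  · simp
  · ext a
    simp only [Finset.mem_filter, Finset.mem_univ, true_and, Finset.mem_powersetCard_univ]
    constructor
    · exact fun h => h.2
    · exact fun h => ⟨by rw [h]; exact Finset.mem_range.1 hj, h⟩
  · intro a ha
    rw [Finset.mem_powersetCard_univ.1 ha]

/-- Union bound: as `κ` is at most the number of clocks, an undecoded window leaves some clock
vacant. Only the exponential decay matters for the correlations. -/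
lemma measureReal_undecoded_le (hy : IsPoissonFamily P μ y) (hμ : 0 < μ) {s t : ℝ}
    (hs : 0 < s) (h : s ≤ t) {κ : ℕ} (hκ : κ ≤ Fintype.card ι) :
    P.real {ω | Undecoded κ (fun i q => y i q ω) s t} ≤
      Fintype.card ι * Real.exp (-(μ * (t - s))) := by
  have hsub : {ω | Undecoded κ (fun i q => y i q ω) s t} ⊆
      ⋃ i, {ω | Vacant (y i · ω) s t} := by
    intro ω hω
    by_contra hc
    simp only [Set.mem_iUnion, Set.mem_ofPred_eq, not_exists] at hc
    have : activeSet (fun i q => y i q ω) s t = Finset.univ := by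
      ext i; simp [mem_activeSet, hc i]
    have hω' : (activeSet (fun i q => y i q ω) s t).card < κ := hω
    rw [this, Finset.card_univ] at hω'
    omega
  refine (measureReal_mono hsub).trans ((measureReal_iUnion_fintype_le _).trans ?_)
  rw [Finset.sum_congr rfl fun i _ => hy.measureReal_vacant hμ i hs h]
  simp

end IsPoissonFamily
end

/-! ### Waiting times: their mean through beta integrals, and their correlations. -/

section

/-- The integrand of a beta integral in exponential coordinates is integrable. -/
lemma integrableOn_pow_mul_exp {μ : ℝ} (hμ : 0 < μ) (j : ℕ) {r : ℕ} (hr : 0 < r) :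
    IntegrableOn (fun x => (1 - Real.exp (-(μ * x))) ^ j * Real.exp (-(μ * x)) ^ r)
      (Set.Ioi 0) := by
  have h := exp_neg_integrableOn_Ioi 0 hμ
  refine Integrable.mono' h (by fun_prop) ?_
  refine (ae_restrict_iff' measurableSet_Ioi).2 (ae_of_all _ fun x hx => ?_)
  have hx : (0 : ℝ) < x := hx
  have h1 : Real.exp (-(μ * x)) ≤ 1 := Real.exp_le_one_iff.2 (by nlinarith)
  have h0 := Real.exp_pos (-(μ * x))
  rw [Real.norm_of_nonneg (mul_nonneg (pow_nonneg (by linarith) _) (by positivity)), neg_mul]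
  calc _ ≤ 1 * Real.exp (-(μ * x)) := by
        refine mul_le_mul (pow_le_one₀ (by linarith) (by linarith)) ?_ (by positivity) one_pos.le
        exact pow_le_of_le_one h0.le h1 hr.ne'
    _ = _ := one_mul _

/-- Integration by parts: `(1 - e) ^ (j + 1) * e ^ r` with `e = exp (-μx)` vanishes at `0` and,
because `r > 0`, at infinity, so its derivative integrates to zero. -/
lemma integral_pow_mul_exp_succ {μ : ℝ} (hμ : 0 < μ) (j : ℕ) {r : ℕ} (hr : 0 < r) :
    r * ∫ x in Set.Ioi (0 : ℝ), (1 - Real.exp (-(μ * x))) ^ (j + 1) * Real.exp (-(μ * x)) ^ r =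
      (j + 1) *
        ∫ x in Set.Ioi (0 : ℝ), (1 - Real.exp (-(μ * x))) ^ j * Real.exp (-(μ * x)) ^ (r + 1) := by
  have hexp : ∀ x, HasDerivAt (fun x => Real.exp (-(μ * x))) (-(μ * Real.exp (-(μ * x)))) x := by
    intro x
    convert! ((hasDerivAt_id x).const_mul μ).neg.exp using 1
    simp; ring
  have hd : ∀ x ∈ Set.Ioi (0 : ℝ),
      HasDerivAt (fun x => (1 - Real.exp (-(μ * x))) ^ (j + 1) * Real.exp (-(μ * x)) ^ r)
      ((j + 1) * μ * ((1 - Real.exp (-(μ * x))) ^ j * Real.exp (-(μ * x)) ^ (r + 1)) -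
        r * μ * ((1 - Real.exp (-(μ * x))) ^ (j + 1) * Real.exp (-(μ * x)) ^ r)) x := by
    intro x _
    have h := (((hexp x).const_sub 1).pow (j + 1)).mul ((hexp x).pow r)
    convert! h using 1
    obtain ⟨r, rfl⟩ := Nat.exists_eq_succ_of_ne_zero hr.ne'
    simp only [Nat.add_sub_cancel, Nat.succ_eq_add_one, Pi.pow_apply]
    push_cast
    ring
  have hi1 := (integrableOn_pow_mul_exp hμ j (Nat.succ_pos r)).const_mul ((j + 1) * μ)
  have hi2 := (integrableOn_pow_mul_exp hμ (j + 1) hr).const_mul (r * μ)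
  have hlim0 : Tendsto (fun x => Real.exp (-(μ * x))) atTop (𝓝 0) :=
    Real.tendsto_exp_atBot.comp (tendsto_neg_atTop_atBot.comp
      (tendsto_id.const_mul_atTop hμ))
  have hlim : Tendsto (fun x => (1 - Real.exp (-(μ * x))) ^ (j + 1) * Real.exp (-(μ * x)) ^ r)
      atTop (𝓝 0) := by
    have := ((hlim0.const_sub 1).pow (j + 1)).mul (hlim0.pow r)
    simpa [hr.ne'] using this
  have h := integral_Ioi_of_hasDerivAt_of_tendsto (a := 0) (by fun_prop) hd (hi1.sub hi2) hlim
  rw [integral_sub hi1 hi2, integral_const_mul, integral_const_mul] at h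
  simp only [mul_zero, neg_zero, Real.exp_zero, sub_self, ne_eq, Nat.add_eq_zero_iff, one_ne_zero,
    and_false, not_false_eq_true, zero_pow, zero_mul] at h
  have : μ * (r * ∫ x in Set.Ioi (0 : ℝ),
      (1 - Real.exp (-(μ * x))) ^ (j + 1) * Real.exp (-(μ * x)) ^ r) = μ * ((j + 1) *
        ∫ x in Set.Ioi (0 : ℝ), (1 - Real.exp (-(μ * x))) ^ j *
          Real.exp (-(μ * x)) ^ (r + 1)) := by linarith
  exact mul_left_cancel₀ hμ.ne' this

/-- The expected time during which exactly `j` of `N` exponential clocks have rung. -/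
lemma choose_mul_integral_pow_mul_exp {μ : ℝ} (hμ : 0 < μ) {N j : ℕ} (hj : j < N) :
    (N.choose j : ℝ) * ∫ x in Set.Ioi (0 : ℝ),
      (1 - Real.exp (-(μ * x))) ^ j * Real.exp (-(μ * x)) ^ (N - j) =
      1 / μ * (1 / ((N - j : ℕ) : ℝ)) := by
  induction j with
  | zero =>
    have : ∀ x : ℝ, (1 - Real.exp (-(μ * x))) ^ 0 * Real.exp (-(μ * x)) ^ (N - 0) =
        Real.exp (-(N * μ) * x) := fun x => by
      rw [pow_zero, one_mul, ← Real.exp_nat_mul]; congr 1; simp; ring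
    simp only [this]
    have hN : (0 : ℝ) < N := by exact_mod_cast hj
    rw [integral_exp_mul_Ioi (by nlinarith)]
    simp
  | succ j ih =>
    have ih := ih (by omega)
    have h := integral_pow_mul_exp_succ hμ j (r := N - (j + 1)) (by omega)
    rw [show N - (j + 1) + 1 = N - j by omega] at h
    have hc : (N.choose (j + 1) : ℝ) * (j + 1) = N.choose j * (N - j : ℕ) := by
      exact_mod_cast Nat.choose_succ_right_eq N j
    have h1 : (0 : ℝ) < (N - (j + 1) : ℕ) := by exact_mod_cast (by omega : 0 < N - (j + 1))
    have h2 : (0 : ℝ) < (N - j : ℕ) := by exact_mod_cast (by omega : 0 < N - j)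
    set I := ∫ x in Set.Ioi (0 : ℝ),
      (1 - Real.exp (-(μ * x))) ^ (j + 1) * Real.exp (-(μ * x)) ^ (N - (j + 1))
    set J := ∫ x in Set.Ioi (0 : ℝ),
      (1 - Real.exp (-(μ * x))) ^ j * Real.exp (-(μ * x)) ^ (N - j)
    -- The binomial coefficient times the integral times `N - j` does not change with `j`; the
    -- induction carries its value `1 / μ`.
    have e : (N.choose (j + 1) : ℝ) * I * (N - (j + 1) : ℕ) = 1 / μ := by
      calc _ = N.choose (j + 1) * (((N - (j + 1) : ℕ) : ℝ) * I) := by ring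
        _ = (N.choose (j + 1) * (j + 1)) * J := by rw [h]; ring
        _ = (N.choose j * J) * (N - j : ℕ) := by rw [hc]; ring
        _ = _ := by rw [ih]; field_simp
    rw [← e]; field_simp

/-- The time during which fewer than `κ` clocks have had an arrival since time `s`. -/
noncomputable def waitingTime {ι : Type*} [Fintype ι] (κ : ℕ) (y : ι → ℕ → ℝ) (s : ℝ) : ENNReal :=
  volume {t | s ≤ t ∧ Undecoded κ y s t}

lemma measurable_waitingTime {α : Type*} [MeasurableSpace α] {ι : Type*} [Fintype ι] {κ : ℕ}
    {y : α → ι → ℕ → ℝ} {s : α → ℝ} (hy : Measurable y) (hs : Measurable s) :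
    Measurable fun a => waitingTime κ (y a) (s a) := by
  have h : MeasurableSet {p : α × ℝ | s p.1 ≤ p.2 ∧ Undecoded κ (y p.1) (s p.1) p.2} :=
    measurableSet_setOfPred.2 (.and
      (measurableSet_setOfPred.1 (measurableSet_le (hs.comp measurable_fst) measurable_snd))
      (measurable_undecoded (hy.comp measurable_fst) (hs.comp measurable_fst) measurable_snd))
  exact measurable_measure_prodMk_left h

/-- The expectation of the waiting time. -/
noncomputable def meanWaitingTime (μ : ℝ) (N κ : ℕ) : ℝ :=
  1 / μ * ∑ j ∈ Finset.range κ, 1 / ((N - j : ℕ) : ℝ)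

variable {Ω : Type*} [MeasurableSpace Ω] {P : Measure Ω} [IsProbabilityMeasure P]
  {ι : Type*} [Fintype ι] {μ : ℝ} {y : ι → ℕ → Ω → ℝ}

namespace IsPoissonFamily

lemma lintegral_waitingTime_eq (hy : IsPoissonFamily P μ y) (κ : ℕ) (s : ℝ) :
    ∫⁻ ω, waitingTime κ (fun i q => y i q ω) s ∂P =
      ∫⁻ t in Set.Ioi s, P {ω | Undecoded κ (fun i q => y i q ω) s t} := by
  have h : MeasurableSet {p : Ω × ℝ | s ≤ p.2 ∧ Undecoded κ (fun i q => y i q p.1) s p.2} :=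
    measurableSet_setOfPred.2 (.and
      (measurableSet_setOfPred.1 (measurableSet_le measurable_const measurable_snd))
      (measurable_undecoded (hy.measurable.comp measurable_fst) measurable_const measurable_snd))
  rw [setLIntegral_congr Ioi_ae_eq_Ici, ← lintegral_indicator measurableSet_Ici]
  refine (Measure.prod_apply (μ := P) (ν := volume) h).symm.trans ?_
  rw [Measure.prod_apply_symm h]
  refine lintegral_congr fun t => ?_
  by_cases ht : s ≤ t
  · rw [Set.indicator_of_mem (by exact ht)]
    congr 1; ext ω; simp [ht]
  · rw [Set.indicator_of_notMem (by exact ht)]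
    convert! measure_empty (μ := P)
    ext ω; simp [ht]

/-- The mean duration is the integral of the binomial tail `f` over the elapsed time `t - s`. Its
`j`-th term is the expected time with exactly `j` active clocks, namely `1 / (μ (N - j))`. -/
theorem lintegral_waitingTime (hy : IsPoissonFamily P μ y) (hμ : 0 < μ) {κ : ℕ}
    (hκ : κ ≤ Fintype.card ι) {s : ℝ} (hs : 0 < s) :
    ∫⁻ ω, waitingTime κ (fun i q => y i q ω) s ∂P =
      ENNReal.ofReal (meanWaitingTime μ (Fintype.card ι) κ) := by
  set N := Fintype.card ι
  let f : ℝ → ℝ := fun x => ∑ j ∈ Finset.range κ, (N.choose j : ℝ) *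
        ((1 - Real.exp (-(μ * x))) ^ j * Real.exp (-(μ * x)) ^ (N - j))
  have hf : IntegrableOn f (Set.Ioi 0) := integrable_finsetSum _ fun j hj =>
    (integrableOn_pow_mul_exp hμ j (by have := Finset.mem_range.1 hj; omega)).const_mul _
  have hint : ∫ x in Set.Ioi (0 : ℝ), f x = meanWaitingTime μ N κ := by
    rw [integral_finsetSum _ fun j hj =>
      (integrableOn_pow_mul_exp hμ j (by have := Finset.mem_range.1 hj; omega)).const_mul _,
      meanWaitingTime, Finset.mul_sum]
    refine Finset.sum_congr rfl fun j hj => ?_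
    rw [integral_const_mul]
    exact choose_mul_integral_pow_mul_exp hμ (by have := Finset.mem_range.1 hj; omega)
  have hf0 : ∀ x ∈ Set.Ioi (0 : ℝ), 0 ≤ f x := fun x hx => by
    have hx : (0 : ℝ) < x := hx
    have h1 : Real.exp (-(μ * x)) ≤ 1 := Real.exp_le_one_iff.2 (by nlinarith)
    refine Finset.sum_nonneg fun j _ => mul_nonneg (by positivity)
      (mul_nonneg (pow_nonneg (by linarith) _) (by positivity))
  rw [hy.lintegral_waitingTime_eq, ← hint, ofReal_integral_eq_lintegral_ofReal hf
    ((ae_restrict_iff' measurableSet_Ioi).2 (ae_of_all _ hf0))]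
  have e : ∀ t ∈ Set.Ioi s, P {ω | Undecoded κ (fun i q => y i q ω) s t} =
      ENNReal.ofReal (f (t - s)) := fun t ht => by
    rw [← ENNReal.ofReal_toReal (measure_ne_top P _)]
    exact congrArg _ (hy.measureReal_undecoded hμ hs (le_of_lt ht) κ)
  rw [setLIntegral_congr_fun measurableSet_Ioi e, ← lintegral_indicator measurableSet_Ioi,
    ← lintegral_indicator measurableSet_Ioi,
    ← lintegral_sub_right_eq_self (fun x => (Set.Ioi (0 : ℝ)).indicator _ x) s]
  refine lintegral_congr fun t => ?_
  simp only [Set.indicator, Set.mem_Ioi, sub_pos]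

lemma lintegral_exp_neg_Ioi {a : ℝ} (ha : 0 < a) (s u : ℝ) :
    ∫⁻ t in Set.Ioi s, ENNReal.ofReal (Real.exp (-(a * (t - u)))) =
      ENNReal.ofReal (Real.exp (-(a * (s - u))) / a) := by
  have e : ∀ t, Real.exp (-(a * (t - u))) = Real.exp (a * u) * Real.exp (-a * t) := fun t => by
    rw [← Real.exp_add]; ring_nf
  rw [← ofReal_integral_eq_lintegral_ofReal _ (ae_of_all _ fun x => Real.exp_nonneg _)]
  · simp only [e]
    rw [integral_const_mul, integral_exp_mul_Ioi (by linarith)]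
    congr 1; field_simp
  · simp only [e]
    exact (exp_neg_integrableOn_Ioi s ha).const_mul _

/-- The correlation of two waiting times decays exponentially in their distance. -/
theorem lintegral_waitingTime_mul_le (hy : IsPoissonFamily P μ y) (hμ : 0 < μ) {κ : ℕ}
    (hκ : κ ≤ Fintype.card ι) {s s' : ℝ} (hs : 0 < s) (hss : s ≤ s') :
    ∫⁻ ω, waitingTime κ (fun i q => y i q ω) s * waitingTime κ (fun i q => y i q ω) s' ∂P ≤
      ENNReal.ofReal (meanWaitingTime μ (Fintype.card ι) κ) ^ 2 +
      ENNReal.ofReal (Fintype.card ι * (2 / μ) ^ 2) *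
        ENNReal.ofReal (Real.exp (-(μ / 2 * (s' - s)))) := by
  set N := Fintype.card ι with hN
  let U : Ω → ℝ → ℝ → Prop := fun ω s t => Undecoded κ (fun i q => y i q ω) s t
  have hs' : 0 < s' := hs.trans_le hss
  set c := ENNReal.ofReal (meanWaitingTime μ N κ) with hc
  let F : ℝ → ℝ → ENNReal := fun s => (Set.Ici s).indicator fun t => P {ω | U ω s t}
  let E : ℝ → ℝ → ENNReal := fun s =>
    (Set.Ici s').indicator fun t => ENNReal.ofReal (Real.exp (-(μ / 2 * (t - s))))
  have hF : ∀ s, 0 < s → ∫⁻ t, F s t = c := fun s hs => by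
    rw [lintegral_indicator measurableSet_Ici, ← setLIntegral_congr Ioi_ae_eq_Ici,
      hc, ← hy.lintegral_waitingTime hμ hκ hs, hy.lintegral_waitingTime_eq]
  have hFt : ∀ s t, F s t ≠ ⊤ := fun s t => by
    by_cases h : s ≤ t
    · simp [F, h]
    · simp [F, h]
  have hE : ∀ s, ∫⁻ t, E s t = ENNReal.ofReal (Real.exp (-(μ / 2 * (s' - s))) / (μ / 2)) :=
    fun s => by
      rw [lintegral_indicator measurableSet_Ici, ← setLIntegral_congr Ioi_ae_eq_Ici,
        lintegral_exp_neg_Ioi (by positivity)]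
  have hEm : ∀ s, Measurable (E s) := fun s =>
    Measurable.indicator (by fun_prop) measurableSet_Ici
  have hm : MeasurableSet {p : Ω × ℝ × ℝ | (s ≤ p.2.1 ∧ U p.1 s p.2.1) ∧
      (s' ≤ p.2.2 ∧ U p.1 s' p.2.2)} := by
    have m1 : Measurable fun p : Ω × ℝ × ℝ => p.2.1 := by fun_prop
    have m2 : Measurable fun p : Ω × ℝ × ℝ => p.2.2 := by fun_prop
    refine measurableSet_setOfPred.2 (.and (.and ?_ ?_) (.and ?_ ?_))
    · exact measurableSet_setOfPred.1 (measurableSet_le measurable_const m1)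
    · exact measurable_undecoded (hy.measurable.comp measurable_fst) measurable_const m1
    · exact measurableSet_setOfPred.1 (measurableSet_le measurable_const m2)
    · exact measurable_undecoded (hy.measurable.comp measurable_fst) measurable_const m2
  have h1 : ∫⁻ ω, waitingTime κ (fun i q => y i q ω) s *
      waitingTime κ (fun i q => y i q ω) s' ∂P =
      ∫⁻ t, ∫⁻ t', P {ω | (s ≤ t ∧ U ω s t) ∧ (s' ≤ t' ∧ U ω s' t')} := by
    have e1 := Measure.prod_apply (μ := P) (ν := (volume : Measure ℝ).prod volume) hm
    have e2 := Measure.prod_apply_symm (μ := P) (ν := (volume : Measure ℝ).prod volume) hm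
    rw [e1, lintegral_prod _ (measurable_measure_prodMk_right hm).aemeasurable] at e2
    refine Eq.trans (lintegral_congr fun ω => ?_) e2
    exact (Measure.prod_prod _ _).symm
  -- If `t < s'` the windows are disjoint and the probability factors. Otherwise it is at most `N *
  -- exp (-μ * max (t - s) (t' - s'))`, and replacing the maximum by the mean of the two lengths
  -- separates the variables. Integrating both half-rate exponentials over `[s', ∞)` yields `(2 / μ)
  -- ^ 2` and the decay in `s' - s`.
  have h2 : ∀ t t', P {ω | (s ≤ t ∧ U ω s t) ∧ (s' ≤ t' ∧ U ω s' t')} ≤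
      F s t * F s' t' + ENNReal.ofReal N * E s t * E s' t' := by
    intro t t'
    by_cases ht : s ≤ t
    swap; · simp [ht]
    by_cases ht' : s' ≤ t'
    swap; · simp [ht']
    simp only [ht, ht', true_and]
    rcases lt_or_ge t s' with hlt | hge
    · refine le_trans (le_of_eq ?_) le_self_add
      have := hy.measureReal_undecoded_inter hμ ht hlt ht' hs κ
      simp only [F, Set.indicator, Set.mem_Ici, ht, ht', if_true]
      rw [← ENNReal.toReal_eq_toReal_iff' (measure_ne_top _ _) (by finiteness), ENNReal.toReal_mul]
      exact this
    · refine le_trans ?_ le_add_self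
      simp only [E, Set.indicator, Set.mem_Ici, hge, ht', if_true]
      rw [← ENNReal.ofReal_mul (by positivity), ← ENNReal.ofReal_mul (by positivity), mul_assoc,
        ← Real.exp_add]
      refine ENNReal.le_ofReal_iff_toReal_le (measure_ne_top _ _) (by positivity) |>.2 ?_
      rcases le_total (t' - s') (t - s) with hle | hle
      · refine (measureReal_mono (fun ω h => h.1)).trans
          ((hy.measureReal_undecoded_le hμ hs ht hκ).trans ?_)
        gcongr
        nlinarith
      · refine (measureReal_mono (fun ω h => h.2)).trans
          ((hy.measureReal_undecoded_le hμ hs' ht' hκ).trans ?_)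
        gcongr
        nlinarith
  rw [h1]
  calc _ ≤ ∫⁻ t, ∫⁻ t', (F s t * F s' t' + ENNReal.ofReal N * E s t * E s' t') :=
        lintegral_mono fun t => lintegral_mono fun t' => h2 t t'
    _ = ∫⁻ t, (F s t * c + ENNReal.ofReal N * E s t * ENNReal.ofReal (1 / (μ / 2))) := by
        refine lintegral_congr fun t => ?_
        rw [lintegral_add_right _ ((hEm s').const_mul _), lintegral_const_mul' _ _ (hFt s t),
          lintegral_const_mul _ (hEm s'), hF s' hs', hE]
        simp
    _ = _ := by
        rw [lintegral_add_right _ (((hEm s).const_mul _).mul_const _),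
          lintegral_mul_const' _ _ ENNReal.ofReal_ne_top,
          lintegral_mul_const _ ((hEm s).const_mul _), lintegral_const_mul _ (hEm s), hF s hs, hE,
          sq]
        congr 1
        rw [← ENNReal.ofReal_mul (by positivity), ← ENNReal.ofReal_mul (by positivity),
          ← ENNReal.ofReal_mul (by positivity)]
        congr 1
        field_simp

end IsPoissonFamily
end

/-! ### A strong law under geometrically decaying correlations, applied to the waiting times. -/

section

variable {Ω : Type*} [MeasurableSpace Ω] {P : Measure Ω} [IsProbabilityMeasure P]

lemma sum_pow_sub_le {ρ : ℝ} (h0 : 0 ≤ ρ) (h1 : ρ < 1) (n : ℕ) :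
    ∑ i ∈ Finset.range n, ρ ^ (n - i) ≤ 1 / (1 - ρ) := by
  rw [← Finset.sum_range_reflect]
  calc _ ≤ ∑ i ∈ Finset.range n, ρ ^ i := by
        refine Finset.sum_le_sum fun i hi => ?_
        have := Finset.mem_range.1 hi
        exact pow_le_pow_of_le_one h0 h1.le (by omega)
    _ ≤ _ := by
        rw [one_div, ← tsum_geometric_of_lt_one h0 h1]
        exact (summable_geometric_of_lt_one h0 h1).sum_le_tsum _ fun i _ => pow_nonneg h0 i

/-- The variance of a sum grows linearly when correlations decay geometrically. -/
lemma integral_sq_sum_sub_le {Y : ℕ → Ω → ℝ} (hL : ∀ l, MemLp (Y l) 2 P) {c K ρ : ℝ}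
    (hK : 0 ≤ K) (h0 : 0 ≤ ρ) (h1 : ρ < 1) (hmean : ∀ l, ∫ ω, Y l ω ∂P = c)
    (hcor : ∀ l d, ∫ ω, Y l ω * Y (l + d) ω ∂P ≤ c ^ 2 + K * ρ ^ d) (n : ℕ) :
    ∫ ω, (∑ i ∈ Finset.range n, (Y i ω - c)) ^ 2 ∂P ≤ (2 * K / (1 - ρ) + K) * n := by
  have hZ : ∀ l, MemLp (fun ω => Y l ω - c) 2 P := fun l => (hL l).sub (memLp_const c)
  have hZZ : ∀ l l', Integrable (fun ω => (Y l ω - c) * (Y l' ω - c)) P :=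
    fun l l' => (hZ l).integrable_mul (hZ l')
  have hcov : ∀ l d, ∫ ω, (Y l ω - c) * (Y (l + d) ω - c) ∂P ≤ K * ρ ^ d := by
    intro l d
    have hi : ∀ l, Integrable (Y l) P := fun l => (hL l).integrable (by norm_num)
    have e : ∀ ω, (Y l ω - c) * (Y (l + d) ω - c) =
        Y l ω * Y (l + d) ω - c * Y l ω - (c * Y (l + d) ω - c ^ 2) := fun ω => by ring
    have i1 : Integrable (fun ω => Y l ω * Y (l + d) ω) P := (hL l).integrable_mul (hL (l + d))
    have i2 := (hi l).const_mul c
    have i3 := (hi (l + d)).const_mul c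
    simp only [e]
    have i4 : Integrable (fun ω => Y l ω * Y (l + d) ω - c * Y l ω) P := i1.sub i2
    have i5 : Integrable (fun ω => c * Y (l + d) ω - c ^ 2) P := i3.sub (integrable_const _)
    rw [integral_sub i4 i5, integral_sub i1 i2,
      integral_sub i3 (integrable_const _), integral_const_mul, integral_const_mul, hmean, hmean]
    simp only [integral_const, probReal_univ, one_smul]
    linarith [hcor l d, sq c]
  -- Adding index `n` adds twice the covariances with the earlier `i`, each at most `K * ρ ^ (n -
  -- i)`, and a diagonal term at most `K`; the geometric series bounds the increment by the claimed
  -- coefficient.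
  induction n with
  | zero => simp
  | succ n ih =>
    have hS : MemLp (fun ω => ∑ i ∈ Finset.range n, (Y i ω - c)) 2 P :=
      memLp_finsetSum _ fun i _ => hZ i
    have e : ∀ ω, (∑ i ∈ Finset.range (n + 1), (Y i ω - c)) ^ 2 =
        (∑ i ∈ Finset.range n, (Y i ω - c)) ^ 2 +
          (2 * ∑ i ∈ Finset.range n, (Y i ω - c) * (Y n ω - c) +
          (Y n ω - c) * (Y n ω - c)) := fun ω => by
      rw [Finset.sum_range_succ, ← Finset.sum_mul]; ring
    have i2 : Integrable (fun ω => 2 * ∑ i ∈ Finset.range n, (Y i ω - c) * (Y n ω - c)) P :=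
      (integrable_finsetSum _ fun i _ => hZZ i n).const_mul 2
    have i3 : Integrable (fun ω => 2 * ∑ i ∈ Finset.range n, (Y i ω - c) * (Y n ω - c) +
        (Y n ω - c) * (Y n ω - c)) P := i2.add (hZZ n n)
    simp only [e]
    rw [integral_add hS.integrable_sq i3, integral_add i2 (hZZ n n),
      integral_const_mul, integral_finsetSum _ fun i _ => hZZ i n]
    have hn := hcov n 0
    rw [add_zero, pow_zero, mul_one] at hn
    have hs : ∑ i ∈ Finset.range n, ∫ ω, (Y i ω - c) * (Y n ω - c) ∂P ≤ K * (1 / (1 - ρ)) :=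
      calc _ ≤ ∑ i ∈ Finset.range n, K * ρ ^ (n - i) := by
            refine Finset.sum_le_sum fun i hi => ?_
            have h := hcov i (n - i)
            rwa [Nat.add_sub_cancel' (Finset.mem_range.1 hi).le] at h
        _ ≤ _ := by
            rw [← Finset.mul_sum]
            exact mul_le_mul_of_nonneg_left (sum_pow_sub_le h0 h1 n) hK
    have e2 : 2 * K / (1 - ρ) = 2 * (K * (1 / (1 - ρ))) := by ring
    push_cast
    rw [e2] at ih ⊢
    linarith

/-- A strong law of large numbers for nonnegative variables with the same mean whose correlations
decay geometrically. -/
theorem ae_tendsto_average_of_correlation_le {Y : ℕ → Ω → ℝ} (hY : ∀ l ω, 0 ≤ Y l ω)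
    (hL : ∀ l, MemLp (Y l) 2 P) {c K ρ : ℝ}
    (hK : 0 ≤ K) (h0 : 0 ≤ ρ) (h1 : ρ < 1) (hmean : ∀ l, ∫ ω, Y l ω ∂P = c)
    (hcor : ∀ l d, ∫ ω, Y l ω * Y (l + d) ω ∂P ≤ c ^ 2 + K * ρ ^ d) :
    ∀ᵐ ω ∂P, Tendsto (fun n : ℕ => (∑ i ∈ Finset.range n, Y i ω) / n) atTop (𝓝 c) := by
  set C := 2 * K / (1 - ρ) + K with hC
  have hC0 : 0 ≤ C := add_nonneg (div_nonneg (by linarith) (by linarith)) hK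
  have hV := integral_sq_sum_sub_le hL hK h0 h1 hmean hcor
  rw [← hC] at hV
  have hT : ∀ n, MemLp (fun ω => ∑ i ∈ Finset.range n, (Y i ω - c)) 2 P := fun n =>
    memLp_finsetSum _ fun i _ => (hL i).sub (memLp_const c)
  -- Squared centred averages along the squares: their means are at most `C / (k + 1) ^ 2`, which is
  -- summable, so `W` tends to `0` almost surely.
  let W : ℕ → Ω → ℝ := fun k ω =>
    ((∑ i ∈ Finset.range ((k + 1) ^ 2), (Y i ω - c)) / ((k + 1) ^ 2 : ℕ)) ^ 2
  have hWi : ∀ k, Integrable (W k) P := fun k => by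
    have := ((hT ((k + 1) ^ 2)).integrable_sq).div_const ((((k + 1) ^ 2 : ℕ) : ℝ) ^ 2)
    refine this.congr (ae_of_all _ fun ω => ?_)
    simp only [W, div_pow]
  have hW : ∀ k, ∫⁻ ω, ENNReal.ofReal (W k ω) ∂P ≤ ENNReal.ofReal (C * (1 / ((k : ℝ) + 1) ^ 2)) := by
    intro k
    rw [← ofReal_integral_eq_lintegral_ofReal (hWi k) (ae_of_all _ fun ω => sq_nonneg _)]
    refine ENNReal.ofReal_le_ofReal ?_
    simp only [W, div_pow]
    rw [integral_div, div_le_iff₀ (by positivity)]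
    refine (hV _).trans (le_of_eq ?_)
    push_cast
    field_simp
  have hsum : ∫⁻ ω, ∑' k, ENNReal.ofReal (W k ω) ∂P ≠ ⊤ := by
    rw [lintegral_tsum fun k => (hWi k).aestronglyMeasurable.aemeasurable.ennreal_ofReal]
    refine ne_top_of_le_ne_top ?_ (ENNReal.tsum_le_tsum hW)
    refine Summable.tsum_ofReal_ne_top (Summable.mul_left C ?_)
    have := (summable_nat_add_iff 1).2 (Real.summable_one_div_nat_pow.2 one_lt_two)
    simpa using this
  have hfin := ae_lt_top' (AEMeasurable.tsum fun k =>
    (hWi k).aestronglyMeasurable.aemeasurable.ennreal_ofReal) hsum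
  filter_upwards [hfin] with ω hω
  have hlim := ENNReal.tendsto_atTop_zero_of_tsum_ne_top hω.ne
  have hlim2 : Tendsto (fun k => W k ω) atTop (𝓝 0) := by
    have := (ENNReal.tendsto_toReal ENNReal.zero_ne_top).comp hlim
    refine this.congr fun k => ?_
    simp only [Function.comp]
    exact ENNReal.toReal_ofReal (sq_nonneg _)
  have hlim3 : Tendsto (fun k : ℕ => (∑ i ∈ Finset.range ((k + 1) ^ 2), (Y i ω - c)) /
      ((k + 1) ^ 2 : ℕ)) atTop (𝓝 0) := by
    have := hlim2.sqrt
    simp only [W, Real.sqrt_sq_eq_abs, Real.sqrt_zero] at this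
    exact (tendsto_zero_iff_abs_tendsto_zero _).2 this
  -- Nonnegative terms make the partial sums monotone, and consecutive squares have ratio tending to
  -- `1`, so convergence along the squares extends to all indices.
  refine tendsto_div_of_monotone_of_exists_subseq_tendsto_div _ c ?_ fun a ha => ?_
  · exact monotone_nat_of_le_succ fun n => by
      rw [Finset.sum_range_succ]; linarith [hY n ω]
  refine ⟨fun k => (k + 1) ^ 2, ?_, ?_, ?_⟩
  · have : Tendsto (fun k : ℕ => (1 + 1 / ((k : ℝ) + 1)) ^ 2) atTop (𝓝 1) := by
      simpa using (tendsto_one_div_add_atTop_nhds_zero_nat (𝕜 := ℝ)).const_add 1 |>.pow 2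
    filter_upwards [this.eventually_le_const ha] with k hk
    push_cast
    have h2 : ((k : ℝ) + 1 + 1) ^ 2 = (1 + 1 / ((k : ℝ) + 1)) ^ 2 * ((k : ℝ) + 1) ^ 2 := by
      field_simp
    rw [h2]
    gcongr
  · exact (tendsto_pow_atTop two_ne_zero).comp (tendsto_add_atTop_nat 1)
  · have := hlim3.add_const c
    rw [zero_add] at this
    refine this.congr fun k => ?_
    have hk : (((k + 1) ^ 2 : ℕ) : ℝ) ≠ 0 := by positivity
    rw [Finset.sum_sub_distrib]
    simp only [Finset.sum_const, Finset.card_range, nsmul_eq_mul]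
    field_simp
    ring

variable {lam μ : ℝ} {g : ℕ → Ω → ℝ} {ι : Type*} [Fintype ι] {y : ι → ℕ → Ω → ℝ}

/-- The Laplace transform of the time between two arrivals is geometric. -/
lemma IsPoissonGaps.exists_mgf_lt_one (hg : IsPoissonGaps P lam g) (hlam : 0 < lam) {a : ℝ}
    (ha : 0 < a) : ∃ ρ : ℝ, 0 ≤ ρ ∧ ρ < 1 ∧ ∀ l d : ℕ,
      ∫⁻ ω, ENNReal.ofReal (Real.exp (-(a * (arrivalTime (g · ω) (l + d) -
        arrivalTime (g · ω) l)))) ∂P = ENNReal.ofReal (ρ ^ d) := by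
  have hmgf : ∀ q, mgf (g q) P (-a) = mgf (g 0) P (-a) := fun q =>
    congrFun (mgf_congr_identDistrib ⟨(hg.measurable q).aemeasurable,
      (hg.measurable 0).aemeasurable, by rw [(hg.law q).map_eq, (hg.law 0).map_eq]⟩) _
  refine ⟨mgf (g 0) P (-a), mgf_nonneg, ?_, fun l d => ?_⟩
  · have hi : Integrable (fun ω => Real.exp (-a * g 0 ω)) P := by
      refine Integrable.mono' (integrable_const 1)
        (by have := hg.measurable 0; fun_prop) ?_
      filter_upwards [hg.ae_pos hlam] with ω hω
      rw [Real.norm_of_nonneg (Real.exp_nonneg _)]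
      exact Real.exp_le_one_iff.2 (by nlinarith [hω 0])
    have hpos : 0 < ∫ ω, (1 - Real.exp (-a * g 0 ω)) ∂P := by
      have hi' : Integrable (fun ω => 1 - Real.exp (-a * g 0 ω)) P := (integrable_const 1).sub hi
      rw [integral_pos_iff_support_of_nonneg_ae _ hi']
      · rw [measure_congr (t := Set.univ)]
        · simp
        · filter_upwards [hg.ae_pos hlam] with ω hω
          have : Real.exp (-a * g 0 ω) < 1 := by
            rw [Real.exp_lt_one_iff]; nlinarith [hω 0]
          refine propext ⟨fun _ => trivial, fun _ => ?_⟩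
          exact (sub_pos.2 this).ne'
      · filter_upwards [hg.ae_pos hlam] with ω hω
        exact sub_nonneg.2 (Real.exp_le_one_iff.2 (by nlinarith [hω 0]))
    rw [integral_sub (integrable_const 1) hi] at hpos
    simp only [integral_const, probReal_univ, one_smul] at hpos
    simpa [mgf] using hpos
  · have h := hg.indep.mgf_sum (t := -a) hg.measurable (Finset.Ico l (l + d))
    rw [Finset.prod_congr rfl fun q _ => hmgf q, Finset.prod_const, Nat.card_Ico,
      Nat.add_sub_cancel_left] at h
    have e : ∀ ω, arrivalTime (g · ω) (l + d) - arrivalTime (g · ω) l =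
        (∑ q ∈ Finset.Ico l (l + d), g q) ω := fun ω => by
      rw [Finset.sum_apply, Finset.sum_Ico_eq_sub _ (by omega)]; rfl
    rw [← h, mgf, ← ofReal_integral_eq_lintegral_ofReal _ (ae_of_all _ fun ω => Real.exp_nonneg _)]
    · simp only [e, neg_mul]
    · refine Integrable.mono' (integrable_const 1) ?_ ?_
      · have := hg.measurable
        unfold arrivalTime
        fun_prop
      · filter_upwards [hg.ae_pos hlam] with ω hω
        have := monotone_arrivalTime hω (show l ≤ l + d by omega)
        rw [Real.norm_of_nonneg (Real.exp_nonneg _)]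
        exact Real.exp_le_one_iff.2 (by nlinarith)

/-- The average time until enough keys of an update have arrived. -/
theorem ae_tendsto_average_waitingTime (hg : IsPoissonGaps P lam g) (hlam : 0 < lam)
    (hy : IsPoissonFamily P μ y) (hμ : 0 < μ)
    (hind : IndepFun (fun ω q => g q ω) (fun ω i q => y i q ω) P) {κ : ℕ}
    (hκ : κ ≤ Fintype.card ι) :
    ∀ᵐ ω ∂P, (∀ l, waitingTime κ (fun i q => y i q ω) (arrivalTime (g · ω) (l + 1)) ≠ ⊤) ∧
      Tendsto (fun n : ℕ => (∑ l ∈ Finset.range n,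
        (waitingTime κ (fun i q => y i q ω) (arrivalTime (g · ω) (l + 1))).toReal) / n) atTop
        (𝓝 (meanWaitingTime μ (Fintype.card ι) κ)) := by
  set c := meanWaitingTime μ (Fintype.card ι) κ with hc
  have hc0 : 0 ≤ c := by rw [hc, meanWaitingTime]; positivity
  -- The exponent `μ / 2` is the decay rate of the correlation of two waiting times; averaging over
  -- the source turns it into `ρ ^ d`.
  obtain ⟨ρ, hρ0, hρ1, hρ⟩ := hg.exists_mgf_lt_one hlam (half_pos hμ)
  set K := (Fintype.card ι : ℝ) * (2 / μ) ^ 2 with hKdef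
  have hK : 0 ≤ K := by positivity
  have hgm : Measurable fun ω q => g q ω := measurable_pi_lambda _ hg.measurable
  -- With the source path frozen, the update times are constants and the estimates for fixed times
  -- apply.
  have hyg := fun {f : (ℕ → ℝ) × (ι → ℕ → ℝ) → ENNReal} (hf : Measurable f) =>
    measure_indepFun_pair hgm hy.measurable hind hf
  let D : ℕ → Ω → ENNReal := fun l ω =>
    waitingTime κ (fun i q => y i q ω) (arrivalTime (g · ω) (l + 1))
  have hτ : ∀ l : ℕ, Measurable fun p : (ℕ → ℝ) × (ι → ℕ → ℝ) => arrivalTime p.1 (l + 1) :=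
    fun l => (measurable_arrivalTime _).comp measurable_fst
  have hDm : ∀ l, Measurable (D l) := fun l =>
    measurable_waitingTime hy.measurable ((measurable_arrivalTime _).comp hgm)
  have hw : ∀ s, Measurable fun z : ι → ℕ → ℝ => waitingTime κ z s := fun s =>
    measurable_waitingTime measurable_id measurable_const
  have hw2 : ∀ s s', Measurable fun z : ι → ℕ → ℝ => waitingTime κ z s * waitingTime κ z s' :=
    fun s s' => (hw s).mul (hw s')
  have hpos : ∀ᵐ ω ∂P, ∀ l, 0 < arrivalTime (g · ω) (l + 1) := by
    filter_upwards [hg.ae_pos hlam] with ω hω l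
    have := monotone_arrivalTime hω (show 0 ≤ l by omega)
    rw [arrivalTime_zero] at this
    rw [arrivalTime_succ]
    linarith [hω l]
  have hmean : ∀ l, ∫⁻ ω, D l ω ∂P = ENNReal.ofReal c := by
    intro l
    have hf : Measurable fun p : (ℕ → ℝ) × (ι → ℕ → ℝ) =>
      waitingTime κ p.2 (arrivalTime p.1 (l + 1)) :=
      measurable_waitingTime measurable_snd (hτ l)
    refine (hyg hf).trans ?_
    rw [lintegral_map hf.lintegral_prod_right' hgm]
    rw [lintegral_congr_ae (g := fun _ => ENNReal.ofReal c)]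
    · simp
    · filter_upwards [hpos] with ω hω
      rw [lintegral_map (hw _) hy.measurable]
      exact hy.lintegral_waitingTime hμ hκ (hω l)
  have hcor : ∀ l d, ∫⁻ ω, D l ω * D (l + d) ω ∂P ≤ ENNReal.ofReal (c ^ 2 + K * ρ ^ d) := by
    intro l d
    have hf : Measurable fun p : (ℕ → ℝ) × (ι → ℕ → ℝ) =>
      waitingTime κ p.2 (arrivalTime p.1 (l + 1)) *
        waitingTime κ p.2 (arrivalTime p.1 (l + d + 1)) :=
      (measurable_waitingTime measurable_snd (hτ l)).mul
        (measurable_waitingTime measurable_snd (hτ (l + d)))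
    refine (hyg hf).le.trans ?_
    rw [lintegral_map hf.lintegral_prod_right' hgm]
    calc _ ≤ ∫⁻ ω, (ENNReal.ofReal c ^ 2 + ENNReal.ofReal K * ENNReal.ofReal (Real.exp
          (-(μ / 2 * (arrivalTime (g · ω) (l + 1 + d) - arrivalTime (g · ω) (l + 1)))))) ∂P := by
          refine lintegral_mono_ae ?_
          filter_upwards [hpos, hg.ae_pos hlam] with ω hω hω'
          rw [lintegral_map (hw2 _ _) hy.measurable,
            show l + 1 + d = l + d + 1 by ring]
          exact hy.lintegral_waitingTime_mul_le hμ hκ (hω l)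
            (monotone_arrivalTime hω' (by omega))
      _ = _ := by
          rw [lintegral_add_left measurable_const, lintegral_const_mul', hρ, lintegral_const,
            measure_univ, mul_one, ← ENNReal.ofReal_pow hc0, ← ENNReal.ofReal_mul hK,
            ← ENNReal.ofReal_add (by positivity) (by positivity)]
          exact ENNReal.ofReal_ne_top
  have hfin : ∀ᵐ ω ∂P, ∀ l, D l ω ≠ ⊤ := by
    refine ae_all_iff.2 fun l => ?_
    filter_upwards [ae_lt_top (hDm l) (by rw [hmean]; exact ENNReal.ofReal_ne_top)] with ω h
    exact h.ne
  refine hfin.and ?_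
  refine ae_tendsto_average_of_correlation_le (P := P) (Y := fun l ω => (D l ω).toReal)
    (fun l ω => ENNReal.toReal_nonneg) (fun l => ?_) hK hρ0 hρ1 (fun l => ?_) (fun l d => ?_)
  -- Square integrability is the correlation bound at distance `d = 0`.
  · refine ⟨(hDm l).ennreal_toReal.aestronglyMeasurable, ?_⟩
    rw [eLpNorm_lt_top_iff_lintegral_rpow_enorm_lt_top two_ne_zero ENNReal.ofNat_ne_top]
    refine lt_of_le_of_lt (lintegral_mono fun ω => ?_)
      ((hcor l 0).trans_lt ENNReal.ofReal_lt_top)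
    simp only [ENNReal.toReal_ofNat, ENNReal.rpow_ofNat, add_zero, ← sq]
    gcongr
    rw [Real.enorm_of_nonneg ENNReal.toReal_nonneg]
    exact ENNReal.ofReal_toReal_le
  · rw [integral_toReal (hDm l).aemeasurable (hfin.mono fun ω h => (h l).lt_top), hmean,
      ENNReal.toReal_ofReal hc0]
  · simp only [← ENNReal.toReal_mul]
    have hDD : Measurable fun ω => D l ω * D (l + d) ω := (hDm l).mul (hDm (l + d))
    rw [integral_toReal hDD.aemeasurable
      (hfin.mono fun ω h => ENNReal.mul_lt_top (h l).lt_top (h (l + d)).lt_top)]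
    exact ENNReal.toReal_le_of_le_ofReal (by positivity) (hcor l d)

end

/-! ### Little's law along a fixed path, and independence of rows of an array. -/

section

/-- If `z q / q → a > 0`, the number of terms of `z` up to time `t` is asymptotic to `t / a`. -/
lemma tendsto_count_div {z : ℕ → ℝ} {a : ℝ} (ha : 0 < a)
    (hz : Tendsto (fun q : ℕ => z q / q) atTop (𝓝 a)) {N : ℝ → ℕ}
    (h1 : ∀ t, t < z (N t + 1)) (h2 : ∀ t q, 1 ≤ q → q ≤ N t → z q ≤ t) :
    Tendsto N atTop atTop ∧ Tendsto (fun t => (N t : ℝ) / t) atTop (𝓝 (1 / a)) := by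
  have hN : Tendsto N atTop atTop := by
    refine tendsto_atTop.2 fun b => ?_
    have : ∀ᶠ t : ℝ in atTop, ∀ q ∈ Finset.range (b + 1), z q ≤ t :=
      (Finset.eventually_all _).2 fun q _ => eventually_ge_atTop _
    filter_upwards [this] with t ht
    by_contra hc
    exact absurd (h1 t) (not_lt.2 (ht _ (Finset.mem_range.2 (by omega))))
  refine ⟨hN, ?_⟩
  have hz1 : Tendsto (fun q : ℕ => z (q + 1) / q) atTop (𝓝 a) := by
    have e1 := hz.comp (tendsto_add_atTop_nat 1)
    have e2 : Tendsto (fun q : ℕ => 1 + 1 / (q : ℝ)) atTop (𝓝 1) := by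
      simpa using (tendsto_one_div_atTop_nhds_zero_nat (𝕜 := ℝ)).const_add 1
    have e3 := e1.mul e2
    rw [mul_one] at e3
    refine e3.congr' ?_
    filter_upwards [eventually_gt_atTop 0] with q hq
    have : (0 : ℝ) < q := by exact_mod_cast hq
    simp only [Function.comp]
    push_cast
    field_simp
  -- Sandwich `z (N t) ≤ t < z (N t + 1)`; monotonicity of `z` is not needed.
  have h : Tendsto (fun t => t / (N t : ℝ)) atTop (𝓝 a) := by
    refine tendsto_of_tendsto_of_tendsto_of_le_of_le' (hz.comp hN) (hz1.comp hN) ?_ ?_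
    · filter_upwards [hN.eventually_ge_atTop 1] with t ht
      exact div_le_div_of_nonneg_right (h2 t _ ht le_rfl) (by positivity)
    · exact Eventually.of_forall fun t => div_le_div_of_nonneg_right (h1 t).le (by positivity)
  simpa using h.inv₀ ha.ne'

lemma exists_count {z : ℕ → ℝ} (hz : Tendsto z atTop atTop) (t : ℝ) :
    ∃ N : ℕ, t < z (N + 1) ∧ ∀ q, 1 ≤ q → q ≤ N → z q ≤ t := by
  classical
  have h : ∃ q : ℕ, t < z (q + 1) :=
    ((hz.comp (tendsto_add_atTop_nat 1)).eventually_gt_atTop t).exists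
  refine ⟨Nat.find h, Nat.find_spec h, fun q hq hqN => ?_⟩
  have := Nat.find_min h (m := q - 1) (by omega)
  rwa [Nat.sub_add_cancel hq, not_lt] at this

lemma tendsto_atTop_of_tendsto_div {z : ℕ → ℝ} {a : ℝ} (ha : 0 < a)
    (hz : Tendsto (fun q : ℕ => z q / q) atTop (𝓝 a)) : Tendsto z atTop atTop := by
  refine (hz.pos_mul_atTop ha (tendsto_natCast_atTop_atTop (R := ℝ))).congr' ?_
  filter_upwards [eventually_gt_atTop 0] with q hq
  have : (q : ℝ) ≠ 0 := by positivity
  field_simp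

/-- If averages converge, a single term is `o(n)`. The shift to `n - 1` matches the indexing in
which `d l` belongs to update `l + 1`. -/
lemma tendsto_term_div {d : ℕ → ℝ} {c : ℝ}
    (hd : Tendsto (fun n : ℕ => (∑ l ∈ Finset.range n, d l) / n) atTop (𝓝 c)) :
    Tendsto (fun n : ℕ => d (n - 1) / n) atTop (𝓝 0) := by
  rw [← tendsto_add_atTop_iff_nat 1]
  have h2 : Tendsto (fun n : ℕ => 1 - 1 / ((n : ℝ) + 1)) atTop (𝓝 1) := by
    simpa using (tendsto_one_div_add_atTop_nhds_zero_nat (𝕜 := ℝ)).const_sub 1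
  have h := (hd.comp (tendsto_add_atTop_nat 1)).sub (hd.mul h2)
  rw [mul_one, sub_self] at h
  refine h.congr' ?_
  filter_upwards [eventually_gt_atTop 0] with n hn
  have hn : (0 : ℝ) < n := by exact_mod_cast hn
  simp only [Function.comp, Finset.sum_range_succ, Nat.add_sub_cancel]
  push_cast
  field_simp
  ring

section path

variable {ι : Type*} [Fintype ι] {κ : ℕ} {y : ι → ℕ → ℝ}

/-- The times at which an update of time `s` has not been decoded yet. -/
def waitingSet (κ : ℕ) (y : ι → ℕ → ℝ) (s : ℝ) : Set ℝ := {t | s ≤ t ∧ Undecoded κ y s t}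

lemma measurableSet_waitingSet (s : ℝ) : MeasurableSet (waitingSet κ y s) :=
  measurableSet_setOfPred.2 (.and
    (measurableSet_setOfPred.1 (measurableSet_le measurable_const measurable_id))
    (measurable_undecoded measurable_const measurable_const measurable_id))

lemma volume_waitingSet (s : ℝ) : volume (waitingSet κ y s) = waitingTime κ y s := rfl

/-- An undecoded window has undecoded subwindows, so the waiting set is an interval starting at `s`,
and its length bounds how far it reaches. -/
lemma le_add_waitingTime {s t : ℝ} (hD : waitingTime κ y s ≠ ⊤) (ht : t ∈ waitingSet κ y s) :
    t ≤ s + (waitingTime κ y s).toReal := by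
  have hsub : Set.Icc s t ⊆ waitingSet κ y s := fun u hu =>
    ⟨hu.1, ht.2.mono le_rfl hu.2⟩
  have h := measure_mono (μ := volume) hsub
  rw [Real.volume_Icc, volume_waitingSet, ENNReal.ofReal_le_iff_le_toReal hD] at h
  linarith

/-- The number of updates that are not decoded yet, as a function of time, when the source follows
the path `x` and the number of updates up to time `t` is `N t`. -/
theorem hasTimeAverage_of_path {x : ℕ → ℝ} {lam c : ℝ} (hlam : 0 < lam) (hx : ∀ q, 0 < x q)
    (hτ : Tendsto (fun q : ℕ => arrivalTime x q / q) atTop (𝓝 (1 / lam)))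
    (hfin : ∀ l, waitingTime κ y (arrivalTime x (l + 1)) ≠ ⊤)
    (hD : Tendsto (fun n : ℕ => (∑ l ∈ Finset.range n,
        (waitingTime κ y (arrivalTime x (l + 1))).toReal) / n) atTop (𝓝 c))
    {N : ℝ → ℕ} (h1 : ∀ t, t < arrivalTime x (N t + 1))
    (h2 : ∀ t q, 1 ≤ q → q ≤ N t → arrivalTime x q ≤ t) {A : ℝ → ℝ}
    (hA : ∀ t, 0 ≤ t → A t = ∑ l ∈ Finset.range (N t),
      (waitingSet κ y (arrivalTime x (l + 1))).indicator 1 t) :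
    HasTimeAverage A (c * lam) := by
  have hmono := monotone_arrivalTime hx
  have hpos : ∀ l, 0 < arrivalTime x (l + 1) := fun l => by
    have := hmono (Nat.zero_le l)
    rw [arrivalTime_zero] at this
    rw [arrivalTime_succ]; linarith [hx l]
  let V : ℕ → Set ℝ := fun l => waitingSet κ y (arrivalTime x (l + 1))
  let D : ℕ → ℝ := fun l => (waitingTime κ y (arrivalTime x (l + 1))).toReal
  have hD0 : ∀ l, 0 ≤ D l := fun l => ENNReal.toReal_nonneg
  have hVm : ∀ l, MeasurableSet (V l) := fun l => measurableSet_waitingSet _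
  -- Updates generated after `t` contribute zero at `t`, so one index set serves all of `[0, T]`.
  have hAT : ∀ T t, 0 ≤ t → t ≤ T → A t = ∑ l ∈ Finset.range (N T), (V l).indicator 1 t := by
    intro T t ht0 htT
    rw [hA t ht0]
    have hle : N t ≤ N T := by
      by_contra hc
      have := h2 t (N T + 1) (by omega) (by omega)
      linarith [h1 T]
    refine Finset.sum_subset (Finset.range_subset_range.2 hle) fun l _ hl => ?_
    refine Set.indicator_of_notMem (fun hv => ?_) _
    have hl' : N t ≤ l := by simpa using hl
    have := hmono (show N t + 1 ≤ l + 1 by omega)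
    linarith [hv.1, h1 t]
  have hInd : ∀ T l, IntervalIntegrable ((V l).indicator (1 : ℝ → ℝ)) volume 0 T := fun T l =>
    intervalIntegrable_iff.2
      ((intervalIntegrable_iff.1 (intervalIntegrable_const (c := (1 : ℝ)))).indicator (hVm l))
  have hSum : ∀ T, IntervalIntegrable
      (fun t => ∑ l ∈ Finset.range (N T), (V l).indicator (1 : ℝ → ℝ) t) volume 0 T := by
    intro T
    have := IntervalIntegrable.sum (μ := volume) (a := 0) (b := T) (Finset.range (N T))
      (f := fun l => (V l).indicator (1 : ℝ → ℝ)) fun l _ => hInd T l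
    refine this.congr fun t _ => ?_
    simp
  have hcongr : ∀ T, 0 ≤ T → Set.EqOn (fun t => ∑ l ∈ Finset.range (N T),
      (V l).indicator (1 : ℝ → ℝ) t) A (Set.uIoc 0 T) := by
    intro T hT t ht
    rw [Set.uIoc_of_le hT] at ht
    exact (hAT T t ht.1.le ht.2).symm
  refine ⟨fun T hT => (hSum T).congr (hcongr T hT), ?_⟩
  have hI : ∀ T, 0 ≤ T → ∫ t in (0 : ℝ)..T, A t =
      ∑ l ∈ Finset.range (N T), volume.real (V l ∩ Set.Ioc 0 T) := by
    intro T hT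
    rw [← intervalIntegral.integral_congr_ae (ae_of_all _ (hcongr T hT)),
      intervalIntegral.integral_finsetSum fun l _ => hInd T l]
    refine Finset.sum_congr rfl fun l _ => ?_
    rw [intervalIntegral.integral_of_le hT, integral_indicator_one (hVm l), Measure.real,
      Measure.restrict_apply (hVm l)]
    rfl
  -- the times at which the updates are decoded
  let σ : ℕ → ℝ := fun q => arrivalTime x q + D (q - 1)
  have hσ : Tendsto (fun q : ℕ => σ q / q) atTop (𝓝 (1 / lam)) := by
    have := hτ.add (tendsto_term_div hD)
    rw [add_zero] at this
    exact this.congr fun q => (add_div _ _ _).symm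
  have hl0 : 0 < 1 / lam := by positivity
  choose M hM1 hM2 using exists_count (tendsto_atTop_of_tendsto_div hl0 hσ)
  obtain ⟨hNt, hNd⟩ := tendsto_count_div hl0 hτ h1 h2
  obtain ⟨hMt, hMd⟩ := tendsto_count_div hl0 hσ hM1 hM2
  rw [one_div_one_div] at hNd hMd
  have hlim : ∀ {K : ℝ → ℕ}, Tendsto K atTop atTop →
      Tendsto (fun t => (K t : ℝ) / t) atTop (𝓝 lam) →
      Tendsto (fun T => (1 / T) * ∑ l ∈ Finset.range (K T), D l) atTop (𝓝 (c * lam)) := by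
    intro K hK hKd
    refine ((hD.comp hK).mul hKd).congr' ?_
    filter_upwards [hK.eventually_ge_atTop 1, eventually_gt_atTop 0] with T hT hT0
    have : (0 : ℝ) < K T := by exact_mod_cast hT
    simp only [Function.comp, D]
    field_simp
  -- Updates counted by `M T` have their whole waiting set inside `(0, T]`; those counted by `N T`
  -- contribute at most their full waiting time. Both counts are asymptotic to `lam * T`, because
  -- single waiting times are `o(n)`.
  refine tendsto_of_tendsto_of_tendsto_of_le_of_le' (hlim hMt hMd) (hlim hNt hNd) ?_ ?_
  · filter_upwards [eventually_gt_atTop 0] with T hT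
    rw [hI T hT.le]
    refine mul_le_mul_of_nonneg_left ?_ (by positivity)
    have hMN : M T ≤ N T := by
      by_contra hc
      have h3 := hM2 T (N T + 1) (by omega) (by omega)
      have h4 := hD0 (N T + 1 - 1)
      have h5 := h1 T
      simp only [σ] at h3
      linarith
    calc _ = ∑ l ∈ Finset.range (M T), volume.real (V l ∩ Set.Ioc 0 T) := by
          refine Finset.sum_congr rfl fun l hl => ?_
          have h3 := hM2 T (l + 1) (by omega) (Finset.mem_range.1 hl)
          rw [Set.inter_eq_left.2]
          · rfl
          · intro t ht
            refine ⟨(hpos l).trans_le ht.1, (le_add_waitingTime (hfin l) ht).trans h3⟩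
      _ ≤ _ := Finset.sum_le_sum_of_subset_of_nonneg (Finset.range_subset_range.2 hMN)
          fun _ _ _ => measureReal_nonneg
  · filter_upwards [eventually_gt_atTop 0] with T hT
    rw [hI T hT.le]
    refine mul_le_mul_of_nonneg_left (Finset.sum_le_sum fun l _ => ?_) (by positivity)
    exact measureReal_mono Set.inter_subset_left (hfin l)

end path

variable {Ω : Type*} [MeasurableSpace Ω] {P : Measure Ω} [IsProbabilityMeasure P]

/-- The rows of an independent array are independent. -/
lemma iIndepFun_curry {κ ν : Type*} {X : κ → ν → Ω → ℝ} (hX : ∀ i j, Measurable (X i j))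
    (h : iIndepFun (fun p : κ × ν => X p.1 p.2) P) : iIndepFun (fun i ω j => X i j ω) P := by
  have : ∀ i j, IsProbabilityMeasure (P.map (X i j)) :=
    fun i j => Measure.isProbabilityMeasure_map (hX i j).aemeasurable
  have hrow : ∀ i, iIndepFun (X i) P := fun i =>
    h.precomp (g := fun j => (i, j)) fun a b hab => (Prod.ext_iff.1 hab).2
  rw [iIndepFun_iff_map_fun_eq_infinitePi_map (by fun_prop)]
  have e := (iIndepFun_iff_map_fun_eq_infinitePi_map
    (X := fun p : κ × ν => X p.1 p.2) (by fun_prop)).1 h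
  -- The joint law is an infinite product; currying makes it the product over rows of the row
  -- products, which are the row laws.
  have e2 := congrArg (Measure.map (MeasurableEquiv.curry κ ν ℝ)) e
  rw [Measure.map_map (by fun_prop) (by fun_prop),
    Measure.infinitePi_map_curry (fun i j => P.map (X i j))] at e2
  refine Eq.trans ?_ (e2.trans ?_)
  · rfl
  · congr 1
    ext1 i
    rw [(iIndepFun_iff_map_fun_eq_infinitePi_map (by fun_prop)).1 (hrow i)]

end

/-! ### From keys in the network to Poisson clocks, and the final formula. -/

section

section path

variable {Ω V : Type*} [Fintype V] [DecidableEq V] {n : ℕ} {S : Finset V} {gap : Clock V → ℕ → Ω → ℝ}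
  {key : Ω → ℕ → V → Option (Fin n)}

/-- The clock of the edge from a subscriber to node `j`. -/
def edgeClock (S : Finset V) (j : V) (i : {i // i ∈ S ∧ i ≠ j}) : Clock V :=
  Clock.edge i.1 j i.2.2

lemma heldKeys_eq_empty {j : V} {l : ℕ} {t : ℝ} {ω : Ω} (ht : t < updateTime gap l ω) :
    heldKeys gap key j l t ω = ∅ := by
  ext a
  simp only [heldKeys, Set.mem_ofPred_eq, Set.mem_empty_iff_false, iff_false]
  rintro (⟨_, h⟩ | ⟨i, hi, _, q, _, h1, h2⟩)
  · linarith
  · linarith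

/-- The nodes whose keys node `j` holds are the subscribers with an active edge to `j`, and `j`
itself if it is a subscriber. -/
lemma ncard_heldKeys (hkey : IsTotalKeySubscription S n key) {j : V} {l : ℕ} {t : ℝ} {ω : Ω}
    (ht : updateTime gap l ω ≤ t) : (heldKeys gap key j l t ω).ncard =
      (if j ∈ S then 1 else 0) +
        (activeSet (fun i q => gap (edgeClock S j i) q ω) (updateTime gap l ω) t).card := by
  set Z := activeSet (fun i q => gap (edgeClock S j i) q ω) (updateTime gap l ω) t with hZ
  -- The nodes whose keys `j` holds. Sending a node to its key is a bijection from `H` to the held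
  -- keys, injective since different nodes get different keys.
  let H : Finset V := (if j ∈ S then {j} else ∅) ∪ Z.map (Function.Embedding.subtype _)
  have hH : ∀ i, i ∈ H ↔ i ∈ S ∧ (i = j ∨ ∃ h : i ≠ j, ¬ Vacant
      (fun q => gap (Clock.edge i j h) q ω) (updateTime gap l ω) t) := by
    intro i
    simp only [H, Finset.mem_union, Finset.mem_map, Function.Embedding.subtype_apply,
      Subtype.exists, exists_and_right, exists_eq_right, hZ, mem_activeSet, edgeClock]
    constructor
    · rintro (h | ⟨h, hv⟩)
      · by_cases hj : j ∈ S
        · simp only [hj, if_true, Finset.mem_singleton] at h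
          exact ⟨h ▸ hj, Or.inl h⟩
        · simp [hj] at h
      · exact ⟨h.1, Or.inr ⟨h.2, hv⟩⟩
    · rintro ⟨hi, rfl | ⟨h, hv⟩⟩
      · left; simp [hi]
      · exact Or.inr ⟨⟨hi, h⟩, hv⟩
  have hcard : H.card = (if j ∈ S then 1 else 0) + Z.card := by
    rw [Finset.card_union_of_disjoint, Finset.card_map]
    · split_ifs <;> simp
    · rw [Finset.disjoint_left]
      intro i hi hi'
      obtain ⟨a, _, rfl⟩ := Finset.mem_map.1 hi'
      split_ifs at hi
      · exact a.2.2 (Finset.mem_singleton.1 hi)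
      · simp at hi
  rw [← hcard, ← Set.ncard_coe_finset]
  have hsome : ∀ i ∈ H, (key ω l i).isSome := fun i hi => (hkey.isSome_iff ω l i).2 ((hH i).1 hi).1
  symm
  refine Set.ncard_congr (fun i hi => (key ω l i).get (hsome i hi)) ?_ ?_ ?_
  · intro i hi
    have hk : key ω l i = some ((key ω l i).get (hsome i hi)) := by simp
    obtain ⟨-, rfl | ⟨h, hv⟩⟩ := (hH i).1 hi
    · exact Or.inl ⟨hk, ht⟩
    · simp only [Vacant, not_forall, not_not] at hv
      obtain ⟨q, hq, h1, h2⟩ := hv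
      exact Or.inr ⟨i, h, hk, q, hq, h1, h2⟩
  · intro i i' hi hi' he
    exact hkey.unique ω l i i' _ (Option.some_get (hsome i hi)).symm
      (by rw [he]; exact (Option.some_get (hsome i' hi')).symm)
  · rintro a (⟨hk, _⟩ | ⟨i, h, hk, q, hq, h1, h2⟩)
    · have hj : j ∈ H := (hH j).2 ⟨(hkey.isSome_iff ω l j).1 (by simp [hk]), Or.inl rfl⟩
      exact ⟨j, hj, by simp [hk]⟩
    · have hi : i ∈ H := (hH i).2 ⟨(hkey.isSome_iff ω l i).1 (by simp [hk]), Or.inr ⟨h,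
        fun hv => hv q hq ⟨h1, h2⟩⟩⟩
      exact ⟨i, hi, by simp [hk]⟩

/-- The number of keys that node `j` has to get over the edges in order to decrypt an update. -/
noncomputable def neededKeys (S : Finset V) (k : ℕ) (j : V) : ℕ := k + 1 - if j ∈ S then 1 else 0

/-- Before the update time no key is held; afterwards a subscriber's own key lowers the threshold
for the edges by one. -/
lemma canDecrypt_iff (hkey : IsTotalKeySubscription S n key) {k : ℕ} {j : V} {l : ℕ} {t : ℝ}
    {ω : Ω} : CanDecrypt gap key k j l t ω ↔ updateTime gap l ω ≤ t ∧
      ¬ Undecoded (neededKeys S k j) (fun i q => gap (edgeClock S j i) q ω)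
        (updateTime gap l ω) t := by
  rcases lt_or_ge t (updateTime gap l ω) with ht | ht
  · simp [CanDecrypt, heldKeys_eq_empty ht, ht]
  · rw [CanDecrypt, ncard_heldKeys hkey ht, Undecoded, neededKeys]
    split_ifs <;> simp [ht]
    omega

/-- The version age is the number of updates that node `j` cannot decrypt yet. -/
lemma versionAge_eq_sum (hkey : IsTotalKeySubscription S n key) {k : ℕ} {j : V} {ω : Ω}
    (hpos : ∀ q, 0 < gap Clock.source q ω) {t : ℝ} {N : ℕ}
    (h1 : t < updateTime gap (N + 1) ω) (h2 : ∀ q, 1 ≤ q → q ≤ N → updateTime gap q ω ≤ t) :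
    versionAge gap key k j t ω = ∑ l ∈ Finset.range N,
      (waitingSet (neededKeys S k j) (fun i q => gap (edgeClock S j i) q ω)
        (updateTime gap (l + 1) ω)).indicator 1 t := by
  classical
  have hmono : Monotone fun l => updateTime gap l ω := monotone_arrivalTime hpos
  have hle : ∀ l, updateTime gap l ω ≤ t → l ≤ N := fun l hl => by
    by_contra hc
    have : updateTime gap (N + 1) ω ≤ updateTime gap l ω := hmono (by omega)
    linarith
  have hsource : sourceVersion gap t ω = N := by
    have : {l : ℕ | 1 ≤ l ∧ updateTime gap l ω ≤ t} = Finset.Icc 1 N := by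
      ext l
      simp only [Set.mem_ofPred_eq, Finset.coe_Icc, Set.mem_Icc]
      exact ⟨fun h => ⟨h.1, hle l h.2⟩, fun h => ⟨h.1, h2 l h.1 h.2⟩⟩
    rw [sourceVersion, this, Set.ncard_coe_finset]; simp
  set B := {l : ℕ | CanDecrypt gap key k j l t ω} with hB
  have hBN : ∀ l ∈ B, l ≤ N := fun l hl => hle l ((canDecrypt_iff hkey).1 hl).1
  have hbdd : BddAbove B := ⟨N, hBN⟩
  have hp : sSup B ≤ N := csSup_le' hBN
  -- Decryptable versions from `1` on form an initial segment, since an older update has a longer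
  -- window. For empty `B` the supremum is `0`, consistent with `1 ≤ l`.
  have hmem : ∀ l, 1 ≤ l → l ≤ N → (l ∈ B ↔ l ≤ sSup B) := by
    intro l hl hlN
    refine ⟨fun h => le_csSup hbdd h, fun h => ?_⟩
    have hne : B.Nonempty := by
      rw [Set.nonempty_iff_ne_empty]
      intro he
      rw [he] at h
      simp at h
      omega
    have hs := (canDecrypt_iff hkey).1 (Nat.sSup_mem hne hbdd)
    exact (canDecrypt_iff hkey).2 ⟨h2 l hl hlN, fun hu => hs.2 (hu.mono (hmono h) le_rfl)⟩
  have hind : ∀ l ∈ Finset.range N, (waitingSet (neededKeys S k j)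
      (fun i q => gap (edgeClock S j i) q ω) (updateTime gap (l + 1) ω)).indicator (1 : ℝ → ℝ) t =
      if sSup B ≤ l then 1 else 0 := by
    intro l hl
    have hlN : l + 1 ≤ N := Finset.mem_range.1 hl
    have hl' := hmem (l + 1) (by omega) hlN
    rw [Set.indicator]
    refine if_congr ?_ rfl rfl
    have : l + 1 ∈ B ↔ _ := canDecrypt_iff hkey
    rw [this] at hl'
    have ht := h2 (l + 1) (by omega) hlN
    simp only [ht, true_and] at hl'
    rw [← not_iff_not, not_le, ← Nat.succ_le_iff, Nat.succ_eq_add_one, ← hl']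
    exact not_congr ⟨fun h => h.2, fun h => ⟨ht, h⟩⟩
  rw [Finset.sum_congr rfl hind, Finset.sum_boole, versionAge, hsource, nodeVersion, ← hB,
    ← Nat.cast_sub hp]
  congr 1
  have : (Finset.range N).filter (fun l => sSup B ≤ l) = Finset.Ico (sSup B) N := by
    ext l; simp [and_comm]
  rw [this, Nat.card_Ico]

end path

variable {Ω V : Type*} [MeasurableSpace Ω] [Fintype V] [DecidableEq V]
  {P : Measure Ω} [IsProbabilityMeasure P]
  {n : ℕ} {S : Finset V} {lamS lamE : ℝ} {gap : Clock V → ℕ → Ω → ℝ}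
  {key : Ω → ℕ → V → Option (Fin n)}

lemma IsScalableHomogeneous.isPoissonGaps (h : IsScalableHomogeneous P lamS lamE gap)
    (c : Clock V) : IsPoissonGaps P (rate V lamS lamE c) (gap c) where
  measurable := h.measurable_gap c
  law := h.law_gap c
  indep := h.indep_gap.precomp (g := fun q => (c, q)) fun _ _ hab => (Prod.ext_iff.1 hab).2

lemma edgeClock_injective (S : Finset V) (j : V) : Function.Injective (edgeClock S j) := by
  intro a b hab
  simp only [edgeClock, Clock.edge.injEq] at hab
  exact Subtype.ext hab.1

lemma IsScalableHomogeneous.isPoissonFamily (h : IsScalableHomogeneous P lamS lamE gap)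
    (j : V) {μ : ℝ} (hμ : ∀ i, rate V lamS lamE (edgeClock S j i) = μ) :
    IsPoissonFamily P μ fun i => gap (edgeClock S j i) where
  poisson i := hμ i ▸ h.isPoissonGaps _
  indep := (iIndepFun_curry h.measurable_gap h.indep_gap).precomp (edgeClock_injective S j)

lemma IsScalableHomogeneous.indepFun (h : IsScalableHomogeneous P lamS lamE gap) (j : V) :
    IndepFun (fun ω q => gap Clock.source q ω) (fun ω i q => gap (edgeClock S j i) q ω) P := by
  classical
  have hrow := (iIndepFun_curry h.measurable_gap h.indep_gap)
  have hm : ∀ c, Measurable fun ω q => gap c q ω := fun c =>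
    measurable_pi_lambda _ (h.measurable_gap c)
  let T : Finset (Clock V) := Finset.univ.image (edgeClock S j)
  have hT : ∀ i, edgeClock S j i ∈ T := fun i => Finset.mem_image_of_mem _ (Finset.mem_univ _)
  have hdis : Disjoint {Clock.source} T := by
    rw [Finset.disjoint_singleton_left]
    intro hc
    obtain ⟨i, _, hi⟩ := Finset.mem_image.1 hc
    simp [edgeClock] at hi
  exact (hrow.indepFun_finset _ T hdis hm).comp
    (φ := fun z : ({Clock.source} : Finset (Clock V)) → ℕ → ℝ => z ⟨Clock.source, by simp⟩)
    (ψ := fun z : T → ℕ → ℝ => fun i => z ⟨_, hT i⟩)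
    (measurable_pi_apply _) (measurable_pi_lambda _ fun i => measurable_pi_apply _)

theorem ae_hasTimeAverage_versionAge (hgap : IsScalableHomogeneous P lamS lamE gap)
    (hS : 0 < lamS) (hkey : IsTotalKeySubscription S n key) {k : ℕ} {j : V} {μ : ℝ} (hμ0 : 0 < μ)
    (hμ : ∀ i, rate V lamS lamE (edgeClock S j i) = μ)
    (hκ : neededKeys S k j ≤ Fintype.card {i // i ∈ S ∧ i ≠ j}) :
    ∀ᵐ ω ∂P, HasTimeAverage (fun t => versionAge gap key k j t ω)
      (meanWaitingTime μ (Fintype.card {i // i ∈ S ∧ i ≠ j}) (neededKeys S k j) * lamS) := by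
  have hg : IsPoissonGaps P lamS (gap Clock.source) := hgap.isPoissonGaps Clock.source
  have hy := hgap.isPoissonFamily (S := S) j hμ
  filter_upwards [hg.ae_pos hS, hg.ae_tendsto_arrivalTime_div hS, hg.ae_tendsto_arrivalTime hS,
    ae_tendsto_average_waitingTime hg hS hy hμ0 (hgap.indepFun j) hκ]
    with ω hpos hτ hτ' ⟨hfin, hD⟩
  choose N h1 h2 using exists_count hτ'
  exact hasTimeAverage_of_path hS hpos hτ hfin hD h1 h2 fun t _ =>
    versionAge_eq_sum hkey hpos (h1 t) (h2 t)

lemma sum_range_one_div_sub (N κ : ℕ) (h : κ ≤ N) :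
    ∑ j ∈ Finset.range κ, 1 / ((N - j : ℕ) : ℝ) =
      ∑ i ∈ Finset.Icc (N + 1 - κ) N, 1 / (i : ℝ) := by
  refine Finset.sum_bij' (fun j _ => N - j) (fun i _ => N - i) ?_ ?_ ?_ ?_ ?_
  · intro j hj
    have := Finset.mem_range.1 hj
    simp only [Finset.mem_Icc]; omega
  · intro i hi
    have := Finset.mem_Icc.1 hi
    simp only [Finset.mem_range]; omega
  · intro j hj
    have := Finset.mem_range.1 hj
    omega
  · intro i hi
    have := Finset.mem_Icc.1 hi
    omega
  · intro j _; rfl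

/-- The average age for a node that needs keys from `κ` of `N` other subscribers. -/
theorem ae_hasTimeAverage_versionAge_of_card (hgap : IsScalableHomogeneous P lamS lamE gap)
    (hS : 0 < lamS) (hE : 0 < lamE) (hkey : IsTotalKeySubscription S n key) {k : ℕ} {j : V}
    {N κ : ℕ} (hN : Fintype.card {i // i ∈ S ∧ i ≠ j} = N) (hκ : neededKeys S k j = κ)
    (hle : κ ≤ N) :
    ∀ᵐ ω ∂P, HasTimeAverage (fun t => versionAge gap key k j t ω)
      (((Fintype.card V : ℝ) - 1) * lamS / lamE *
        ∑ i ∈ Finset.Icc (N + 1 - κ) N, 1 / (i : ℝ)) := by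
  -- Without other subscribers `m - 1` may be `0`, and the edge rate need not be positive. Then `κ =
  -- N = 0`, no edge matters, and any positive rate, here `1`, gives the value `0`.
  rcases isEmpty_or_nonempty {i // i ∈ S ∧ i ≠ j} with he | ⟨i, hi⟩
  · have hN0 : N = 0 := by rw [← hN]; exact Fintype.card_eq_zero
    have hκ0 : κ = 0 := by omega
    have h := ae_hasTimeAverage_versionAge hgap hS hkey (k := k) (j := j) one_pos
      (fun i => he.elim i) (by omega)
    simpa [hN, hκ, hN0, hκ0, meanWaitingTime] using h
  · have hV : (1 : ℝ) < Fintype.card V := by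
      exact_mod_cast Fintype.one_lt_card_iff.2 ⟨i, j, hi.2⟩
    have hV' : (0 : ℝ) < Fintype.card V - 1 := by linarith
    have h := ae_hasTimeAverage_versionAge hgap hS hkey (k := k) (j := j)
      (μ := lamE / ((Fintype.card V : ℝ) - 1)) (by positivity) (fun i => rfl) (by omega)
    rw [hN, hκ, meanWaitingTime, sum_range_one_div_sub N κ hle] at h
    convert h using 3
    field_simp

lemma card_subscribers_ne (S : Finset V) (j : V) :
    Fintype.card {i // i ∈ S ∧ i ≠ j} = (S.erase j).card := by
  rw [Fintype.card_subtype]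
  congr 1
  ext i; simp [and_comm]

end

end GossipAge

theorem mainTheorem4 {Ω V : Type*} [MeasurableSpace Ω] [Fintype V]
    (P : Measure Ω) [IsProbabilityMeasure P]
    (m n k : ℕ) (hm : Fintype.card V = m) (hk : k < n)
    (lamS lamE : ℝ) (hS : 0 < lamS) (hE : 0 < lamE)
    (gap : GossipAge.Clock V → ℕ → Ω → ℝ)
    (hgap : GossipAge.IsScalableHomogeneous P lamS lamE gap)
    (S : Finset V) (key : Ω → ℕ → V → Option (Fin n))
    (hkey : GossipAge.IsTotalKeySubscription S n key) :
    (∀ j ∈ S, ∀ᵐ ω ∂P, GossipAge.HasTimeAverage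
      (fun t => GossipAge.versionAge gap key k j t ω)
      (((m : ℝ) - 1) * lamS / lamE * ∑ i ∈ Finset.Icc (n - k) (n - 1), 1 / (i : ℝ))) ∧
    (∀ j ∉ S, ∀ᵐ ω ∂P, GossipAge.HasTimeAverage
      (fun t => GossipAge.versionAge gap key k j t ω)
      (((m : ℝ) - 1) * lamS / lamE * ∑ i ∈ Finset.Icc (n - k) n, 1 / (i : ℝ))) := by
  classical
  subst hm
  have hcard := hkey.card_eq
  refine ⟨fun j hj => ?_, fun j hj => ?_⟩
  · have hN : Fintype.card {i // i ∈ S ∧ i ≠ j} = n - 1 := by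
      rw [← hcard, ← Finset.card_erase_of_mem hj, ← GossipAge.card_subscribers_ne]
    -- For `k = 0` the subscriber decrypts at once; the sum from `n` to `n - 1` is then empty.
    have hκ : GossipAge.neededKeys S k j = k := by simp [GossipAge.neededKeys, hj]
    have h := GossipAge.ae_hasTimeAverage_versionAge_of_card hgap hS hE hkey hN hκ (by omega)
    rwa [show n - 1 + 1 - k = n - k by omega] at h
  · have hN : Fintype.card {i // i ∈ S ∧ i ≠ j} = n := by
      rw [← hcard, ← Finset.erase_eq_of_notMem hj, ← GossipAge.card_subscribers_ne]
      refine Fintype.card_congr (Equiv.subtypeEquivRight fun i => ?_)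
      simp [hj]
    have hκ : GossipAge.neededKeys S k j = k + 1 := by simp [GossipAge.neededKeys, hj]
    have h := GossipAge.ae_hasTimeAverage_versionAge_of_card hgap hS hE hkey hN hκ hk
    rwa [show n + 1 - (k + 1) = n - k by omega] at h
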